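/- For $N \ge 1$ let $P_N$ be the joint eigenvalue law of the complex Ginibre ensemble with entries of variance $1/N$, that is, the probability measure on $\mathbb{C}^N$ $$dP_N(z_1,\dots,z_N) = \frac{1}{Z_N} \prod_{1 \le \ell < k \le N} |z_\ell - z_k|^2 \prod_{k=1}^N e^{-N|z_k|^2}\, d\Re(z_k)\, d\Im(z_k),$$ where $Z_N$ is the normalizing constant. For $F : \mathbb{C} \to \mathbb{R}$ write $X(F) = \sum_{k=1}^N F(z_k)$, and let $E$ and $\mathrm{Cov}_N$ denote expectation and covariance under $P_N$. Let $\delta > 0$ and $\varepsilon > 0$, and let $f(z) = f(|z|)$ and $g(z) = g(|z|)$ be bounded measurable real-valued radial functions on $\mathbb{C}$ which, as functions of $r = |z|$, belong to $C^{2,\delta}$ on $(0, 1+\varepsilon)$ with finite $C^{2,\delta}$ norm: they are twice continuously differentiable there, the functions and their first two derivatives are bounded there, and their second derivatives are uniformly $\delta$-Hölder continuous there. Then $f'(r) g'(r) r$ is integrable on $(0,1)$ and $$\lim_{N \to \infty} \mathrm{Cov}_N\bigl(X(f), X(g)\bigr) = \frac{1}{2} \int_0^1 f'(r)\, g'(r)\,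 r \, dr .$$ Moreover, as $N \to \infty$, the centered (but unnormalized) random variable $X(f) - E[X(f)]$ converges in distribution to a Gaussian random variable with mean zero and variance $\frac{1}{2} \int_0^1 f'(r)^2\, r \, dr$ (a point mass at $0$ if this variance vanishes). -/

import Mathlib

open MeasureTheory ProbabilityTheory Filter Set
open scoped NNReal ENNReal Topology

noncomputable section

/-- The (unnormalized) Gaussian weight `μ_N(dz) = exp (-N |z|²) d Re z d Im z` on `ℂ`. -/
def gaussianWeight (N : ℕ) : Measure ℂ :=
  (volume : Measure ℂ).withDensity fun z => ENNReal.ofReal (Real.exp (-(N : ℝ) * ‖z‖ ^ 2))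

/-- The squared modulus of the Vandermonde determinant, `∏_{l < k} |z_l - z_k|²`. -/
def vandermondeSq {N : ℕ} (z : Fin N → ℂ) : ℝ :=
  ∏ l : Fin N, ∏ k ∈ Finset.Ioi l, ‖z l - z k‖ ^ 2

/-- The measure `∏_{l < k} |z_l - z_k|² μ_N(dz_1) ⋯ μ_N(dz_N)` on `ℂ^N`. -/
def ginibreUnnormalized (N : ℕ) : Measure (Fin N → ℂ) :=
  (Measure.pi fun _ : Fin N => gaussianWeight N).withDensity
    fun z => ENNReal.ofReal (vandermondeSq z)

/-- The joint law `P_N` of the eigenvalues of the complex Ginibre ensemble, with entries of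
variance `1 / N`: the preceding measure divided by its total mass `Z_N`. -/
def ginibre (N : ℕ) : Measure (Fin N → ℂ) :=
  (ginibreUnnormalized N univ)⁻¹ • ginibreUnnormalized N

/-- The linear statistic `∑_k F (z_k)`. -/
def linearStatistic (N : ℕ) (F : ℂ → ℝ) (z : Fin N → ℂ) : ℝ :=
  ∑ k, F (z k)

/-- The radial function `z ↦ f |z|` on `ℂ` with profile `f`; only the values of `f` on `[0, ∞)`
matter. -/
def radial (f : ℝ → ℝ) (z : ℂ) : ℝ := f ‖z‖

/-- The Hölder class `C^{2,δ}(s)` for an open set `s` of reals, that is finiteness of the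
`C^{2,δ}` norm: `f` is `C²` on `s`, the derivatives of order at most two are bounded on `s`, and
the second derivative is (uniformly) `δ`-Hölder on `s`. -/
structure MemC2Holder (δ : ℝ≥0) (f : ℝ → ℝ) (s : Set ℝ) : Prop where
  contDiffOn : ContDiffOn ℝ 2 f s
  bounded : ∀ k ≤ 2, ∃ M : ℝ, ∀ x ∈ s, |iteratedDerivWithin k f s x| ≤ M
  holder : ∃ C : ℝ≥0, HolderOnWith C δ (iteratedDerivWithin 2 f s) s

/-- The test functions: measurable radial functions, bounded, and `C^{2,δ}` in the radial variable
`r ∈ (0, 1 + ε)`. -/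
structure IsRadialTest (δ : ℝ≥0) (ε : ℝ) (f : ℝ → ℝ) : Prop where
  measurable : Measurable (radial f)
  bounded : ∃ M : ℝ, ∀ r, 0 ≤ r → |f r| ≤ M
  memC2Holder : MemC2Holder δ f (Ioo 0 (1 + ε))

/-- The limiting covariance `(1/2) ∫₀¹ f'(r) g'(r) r dr`. -/
def limitCov (f g : ℝ → ℝ) : ℝ :=
  (1 / 2) * ∫ r in (0 : ℝ)..1, deriv f r * deriv g r * r

theorem limitCov_self_nonneg (f : ℝ → ℝ) : 0 ≤ limitCov f f := by
  unfold limitCov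
  refine mul_nonneg (by norm_num) (intervalIntegral.integral_nonneg zero_le_one ?_)
  intro r hr
  exact mul_nonneg (mul_self_nonneg _) hr.1

theorem one_add_norm_pow_le (m N : ℕ) (hN : 0 < N) (z : ℂ) :
    (1 + ‖z‖) ^ m * Real.exp (-(N : ℝ) * ‖z‖ ^ 2) ≤
      (m.factorial * Real.exp 2) * Real.exp (-(1 / 2 : ℝ) * ‖z‖ ^ 2) := by
  have hN' : (1 : ℝ) ≤ N := by exact_mod_cast hN
  have h0 : 0 ≤ ‖z‖ := norm_nonneg z
  have h1 : (1 + ‖z‖) ^ m ≤ m.factorial * Real.exp (1 + ‖z‖) := by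
    have := Real.pow_div_factorial_le_exp (1 + ‖z‖) (by positivity) m
    rwa [div_le_iff₀ (by positivity), mul_comm] at this
  calc (1 + ‖z‖) ^ m * Real.exp (-(N : ℝ) * ‖z‖ ^ 2)
      ≤ (m.factorial * Real.exp (1 + ‖z‖)) * Real.exp (-(N : ℝ) * ‖z‖ ^ 2) := by gcongr
    _ = m.factorial * Real.exp (1 + ‖z‖ + -(N : ℝ) * ‖z‖ ^ 2) := by
        rw [mul_assoc, ← Real.exp_add]
    _ ≤ m.factorial * Real.exp (2 + -(1 / 2 : ℝ) * ‖z‖ ^ 2) := by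
        refine mul_le_mul_of_nonneg_left (Real.exp_le_exp.2 ?_) (by positivity)
        nlinarith [sq_nonneg (‖z‖ - 1), mul_nonneg (sub_nonneg.2 hN') (sq_nonneg ‖z‖)]
    _ = _ := by rw [mul_assoc, ← Real.exp_add]

theorem integrable_one_add_norm_pow (m N : ℕ) (hN : 0 < N) :
    Integrable (fun z : ℂ => (1 + ‖z‖) ^ m * Real.exp (-(N : ℝ) * ‖z‖ ^ 2)) := by
  have hg : Integrable (fun z : ℂ => Real.exp (-(1 / 2 : ℝ) * ‖z‖ ^ 2)) := by
    have h := (GaussianFourier.integrable_cexp_neg_mul_sq_norm_add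
      (V := ℂ) (b := (1 / 2 : ℂ)) (by norm_num) 0 0).norm
    refine h.congr (ae_of_all _ fun z => ?_)
    simp only [Complex.norm_exp]
    congr 1
    have : (-(1 / 2 : ℂ) * (‖z‖ : ℂ) ^ 2 + 0 * (inner ℝ (0 : ℂ) z : ℝ)) =
        ((-(1 / 2 : ℝ) * ‖z‖ ^ 2 : ℝ) : ℂ) := by push_cast; ring
    rw [this, Complex.ofReal_re]
  refine (hg.const_mul (m.factorial * Real.exp 2)).mono' (by fun_prop) (ae_of_all _ fun z => ?_)
  rw [Real.norm_of_nonneg (by positivity)]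
  exact one_add_norm_pow_le m N hN z

theorem measurable_gaussianDensity (N : ℕ) :
    Measurable fun z : ℂ => ENNReal.ofReal (Real.exp (-(N : ℝ) * ‖z‖ ^ 2)) := by
  fun_prop

theorem integrable_gaussianWeight (m N : ℕ) (hN : 0 < N) :
    Integrable (fun z : ℂ => (1 + ‖z‖) ^ m) (gaussianWeight N) := by
  unfold gaussianWeight
  rw [integrable_withDensity_iff (measurable_gaussianDensity N) (ae_of_all _ fun _ => by simp)]
  refine (integrable_one_add_norm_pow m N hN).congr (ae_of_all _ fun z => ?_)
  simp only [ENNReal.toReal_ofReal (Real.exp_nonneg _)]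

instance instSigmaFiniteGaussianWeight (N : ℕ) : SigmaFinite (gaussianWeight N) :=
  SigmaFinite.withDensity_ofReal _

instance instIsOpenPosMeasureGaussianWeight (N : ℕ) :
    (gaussianWeight N).IsOpenPosMeasure := by
  refine Measure.AbsolutelyContinuous.isOpenPosMeasure
    (withDensity_absolutelyContinuous' (measurable_gaussianDensity N).aemeasurable ?_)
  exact ae_of_all _ fun z => by simp [Real.exp_pos]

theorem vandermondeSq_nonneg {N : ℕ} (z : Fin N → ℂ) : 0 ≤ vandermondeSq z :=
  Finset.prod_nonneg fun _ _ => Finset.prod_nonneg fun _ _ => by positivity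

theorem continuous_vandermondeSq (N : ℕ) :
    Continuous (vandermondeSq : (Fin N → ℂ) → ℝ) := by
  unfold vandermondeSq
  fun_prop

theorem vandermondeSq_le {N : ℕ} (z : Fin N → ℂ) :
    vandermondeSq z ≤ ∏ k : Fin N, (1 + ‖z k‖) ^ (2 * N * N) := by
  set P : ℝ := ∏ k : Fin N, (1 + ‖z k‖) with hP
  have hone : ∀ k : Fin N, (1 : ℝ) ≤ 1 + ‖z k‖ := fun k => by linarith [norm_nonneg (z k)]
  have hP1 : 1 ≤ P := by
    have h := Finset.prod_le_prod (s := (Finset.univ : Finset (Fin N))) (f := fun _ => (1 : ℝ))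
      (fun _ _ => zero_le_one) fun k _ => hone k
    rwa [Finset.prod_const_one] at h
  have hpair : ∀ l : Fin N, ∀ k ∈ Finset.Ioi l, ‖z l - z k‖ ^ 2 ≤ P ^ 2 := by
    intro l k hk
    have hlk : l ≠ k := (Finset.mem_Ioi.1 hk).ne
    have h2 : (1 + ‖z l‖) * (1 + ‖z k‖) ≤ P := by
      rw [hP, ← Finset.prod_pair (f := fun j => 1 + ‖z j‖) hlk]
      exact Finset.prod_le_prod_of_subset_of_one_le (Finset.subset_univ _)
        (fun j _ => by positivity) fun j _ _ => hone j
    refine pow_le_pow_left₀ (norm_nonneg _) (le_trans ?_ h2) 2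
    nlinarith [norm_sub_le (z l) (z k), norm_nonneg (z l), norm_nonneg (z k),
      mul_nonneg (norm_nonneg (z l)) (norm_nonneg (z k))]
  have hrow : ∀ l : Fin N, ∏ k ∈ Finset.Ioi l, ‖z l - z k‖ ^ 2 ≤ (P ^ 2) ^ N := by
    intro l
    calc ∏ k ∈ Finset.Ioi l, ‖z l - z k‖ ^ 2 ≤ ∏ k ∈ Finset.Ioi l, P ^ 2 :=
          Finset.prod_le_prod (fun _ _ => by positivity) (hpair l)
      _ = (P ^ 2) ^ (Finset.Ioi l).card := by rw [Finset.prod_const]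
      _ ≤ (P ^ 2) ^ N := by
          refine pow_le_pow_right₀ (one_le_pow₀ hP1) ?_
          simpa using Finset.card_le_univ (Finset.Ioi l)
  calc vandermondeSq z ≤ ∏ _l : Fin N, (P ^ 2) ^ N :=
        Finset.prod_le_prod (fun _ _ => Finset.prod_nonneg fun _ _ => by positivity)
          fun l _ => hrow l
    _ = P ^ (2 * N * N) := by simp [← pow_mul]
    _ = _ := by rw [hP, Finset.prod_pow]

theorem ginibreUnnormalized_ne_top (N : ℕ) : ginibreUnnormalized N univ ≠ ∞ := by
  unfold ginibreUnnormalized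
  rw [withDensity_apply _ MeasurableSet.univ, Measure.restrict_univ]
  have hint : Integrable (fun z : Fin N → ℂ => ∏ k, (1 + ‖z k‖) ^ (2 * N * N))
      (Measure.pi fun _ : Fin N => gaussianWeight N) := by
    refine Integrable.fintype_prod (f := fun _ w => (1 + ‖w‖) ^ (2 * N * N)) fun k => ?_
    exact integrable_gaussianWeight _ N (Fin.pos k)
  have hv : Integrable (vandermondeSq : (Fin N → ℂ) → ℝ)
      (Measure.pi fun _ : Fin N => gaussianWeight N) := by
    refine hint.mono' (continuous_vandermondeSq N).aestronglyMeasurable (ae_of_all _ fun z => ?_)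
    rw [Real.norm_of_nonneg (vandermondeSq_nonneg z)]
    exact vandermondeSq_le z
  exact hv.lintegral_lt_top.ne

theorem ginibreUnnormalized_ne_zero (N : ℕ) : ginibreUnnormalized N univ ≠ 0 := by
  unfold ginibreUnnormalized
  have hc : Continuous fun z : Fin N → ℂ => ENNReal.ofReal (vandermondeSq z) :=
    ENNReal.continuous_ofReal.comp (continuous_vandermondeSq N)
  rw [withDensity_apply _ MeasurableSet.univ, Measure.restrict_univ]
  refine ((lintegral_pos_iff_support hc.measurable).2 ?_).ne'
  refine (hc.isOpen_support).measure_pos _ ⟨fun k => ((k : ℕ) : ℂ), ?_⟩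
  rw [Function.mem_support]
  refine (ENNReal.ofReal_pos.2 ?_).ne'
  refine Finset.prod_pos fun l _ => Finset.prod_pos fun k hk => ?_
  have hlk : ((l : ℕ) : ℂ) - ((k : ℕ) : ℂ) ≠ 0 := by
    rw [sub_ne_zero]
    intro h
    exact (Finset.mem_Ioi.1 hk).ne (Fin.ext (by exact_mod_cast h))
  exact pow_pos (norm_pos_iff.2 hlk) 2

instance instIsProbabilityMeasureGinibre (N : ℕ) : IsProbabilityMeasure (ginibre N) :=
  ⟨by
    unfold ginibre
    rw [Measure.smul_apply, smul_eq_mul]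
    exact ENNReal.inv_mul_cancel (ginibreUnnormalized_ne_zero N) (ginibreUnnormalized_ne_top N)⟩

end

/-!
By Kostlan's theorem the squared moduli of the Ginibre eigenvalues, as an unordered family, are
independent Gamma variables `G_k`, `k < N`, of mean `c = (k + 1) / N` and variance `c / N`: angular
orthogonality of the monomials diagonalizes the Gram matrix in the Andréief expansion of
`E ∏ h(|z_k|²)`. Hence `X(f)` is distributed as the sum of the independent variables `f(√G_k)`.
Each `G_k` concentrates at scale `N ^ (-1/2)`, so the delta method turns `N * Var f(√G_k)` into
`(f ∘ √)'(c)² c = f'(√c)² / 4` wherever `f` is differentiable at `√c`. The variances are therefore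
Riemann sums for `∫ f'(√u)² / 4 du = ½ ∫ f'(r)² r dr`, covariances follow by polarization, and the
fourth moments are `O(N⁻²)` each, so that Lyapunov's condition gives the central limit theorem.
A Lipschitz profile is differentiable almost everywhere, which is enough for the Riemann sums.
-/

section CauchySchwarz

variable {α : Type*} [MeasurableSpace α] {μ : Measure α}

theorem sq_integral_mul_le {f g : α → ℝ} (hf : MemLp f 2 μ) (hg : MemLp g 2 μ) :
    (∫ x, f x * g x ∂μ) ^ 2 ≤ (∫ x, f x ^ 2 ∂μ) * ∫ x, g x ^ 2 ∂μ := by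
  have hfg : Integrable (fun x => f x * g x) μ := hf.integrable_mul hg
  have hquad (t : ℝ) : 0 ≤ (∫ x, f x ^ 2 ∂μ) * (t * t) + 2 * (∫ x, f x * g x ∂μ) * t +
      ∫ x, g x ^ 2 ∂μ := by
    calc 0 ≤ ∫ x, (t * f x + g x) ^ 2 ∂μ := integral_nonneg fun x => sq_nonneg _
      _ = ∫ x, (t * t * f x ^ 2 + 2 * t * (f x * g x) + g x ^ 2) ∂μ :=
        integral_congr_ae (ae_of_all _ fun x => by ring)
      _ = _ := by
        rw [integral_add ((hf.integrable_sq.const_mul _).fun_add (hfg.const_mul _))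
          hg.integrable_sq,
          integral_add (hf.integrable_sq.const_mul _) (hfg.const_mul _), integral_const_mul,
          integral_const_mul]
        ring
  have hdiscrim := discrim_le_zero hquad
  unfold discrim at hdiscrim
  linarith

theorem memLp_two_sq {f : α → ℝ} (hf : MemLp f 4 μ) : MemLp (fun x => f x ^ 2) 2 μ := by
  have : (4 : ℝ≥0∞) / 2 = 2 := by
    refine ((ENNReal.eq_div_iff (by norm_num) (by norm_num)).2 ?_).symm
    norm_num
  simpa [sq_abs, this] using hf.norm_rpow_div 2

theorem integral_abs_pow_three_le [IsFiniteMeasure μ] {f : α → ℝ} (hf : MemLp f 4 μ) :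
    ∫ x, |f x| ^ 3 ∂μ ≤ √((∫ x, f x ^ 2 ∂μ) * ∫ x, f x ^ 4 ∂μ) := by
  refine Real.le_sqrt_of_sq_le ?_
  have hf2 : MemLp f 2 μ := hf.mono_exponent (by norm_num)
  calc (∫ x, |f x| ^ 3 ∂μ) ^ 2 = (∫ x, |f x| * f x ^ 2 ∂μ) ^ 2 := by
        simp only [← sq_abs (f _), ← pow_succ']
    _ ≤ (∫ x, |f x| ^ 2 ∂μ) * ∫ x, (f x ^ 2) ^ 2 ∂μ :=
        sq_integral_mul_le hf2.abs (memLp_two_sq hf)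
    _ = _ := by simp only [sq_abs, ← pow_mul, Nat.reduceMul]

end CauchySchwarz

section Lyapunov

theorem norm_exp_mul_I_sub_taylor_two_le (x : ℝ) :
    ‖Complex.exp (x * Complex.I) - (1 + x * Complex.I - x ^ 2 / 2)‖ ≤ 4 * |x| ^ 3 := by
  rcases le_total |x| 1 with h | h
  · have htaylor : (∑ m ∈ Finset.range 3, (x * Complex.I) ^ m / (m.factorial : ℂ)) =
        1 + x * Complex.I - x ^ 2 / 2 := by
      simp [Finset.sum_range_succ, mul_pow, Nat.factorial]
      ring
    have hrem := Complex.norm_exp_sub_sum_le_norm_mul_exp (x * Complex.I) 3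
    rw [htaylor, norm_mul, Complex.norm_I, mul_one, Complex.norm_real, Real.norm_eq_abs] at hrem
    refine hrem.trans ?_
    rw [mul_comm]
    gcongr
    linarith [Real.exp_one_lt_d9, Real.exp_le_exp.2 h]
  · have hpoly : ‖(1 + x * Complex.I - x ^ 2 / 2 : ℂ)‖ ≤ 1 + |x| + |x| ^ 2 / 2 := by
      refine (norm_sub_le _ _).trans (add_le_add ((norm_add_le _ _).trans ?_) ?_) <;> simp
    have hone : |x| ≤ |x| ^ 3 := le_self_pow₀ h (by norm_num)
    have htwo : |x| ^ 2 ≤ |x| ^ 3 := pow_le_pow_right₀ h (by norm_num)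
    refine (norm_sub_le _ _).trans ?_
    rw [Complex.norm_exp_ofReal_mul_I]
    linarith

theorem abs_exp_neg_sub_one_sub_le {y : ℝ} (hy : 0 ≤ y) :
    |Real.exp (-y) - (1 - y)| ≤ y ^ 2 := by
  have hinv : Real.exp (-y) ≤ 1 / (1 + y) := by
    rw [Real.exp_neg, ← one_div]
    exact one_div_le_one_div_of_le (by linarith) (by linarith [Real.add_one_le_exp y])
  have hgeom : 1 / (1 + y) ≤ 1 - y + y ^ 2 := by
    rw [div_le_iff₀ (by linarith)]
    nlinarith [pow_nonneg hy 3]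
  rw [abs_of_nonneg (by linarith [Real.add_one_le_exp (-y)])]
  linarith

theorem norm_prod_sub_prod_le {ι R : Type*} [NormedCommRing R] [NormOneClass R] (s : Finset ι)
    {a b : ι → R} (ha : ∀ i ∈ s, ‖a i‖ ≤ 1) (hb : ∀ i ∈ s, ‖b i‖ ≤ 1) :
    ‖∏ i ∈ s, a i - ∏ i ∈ s, b i‖ ≤ ∑ i ∈ s, ‖a i - b i‖ := by
  induction s using Finset.cons_induction with
  | empty => simp
  | cons i s hi ih =>
    simp only [Finset.forall_mem_cons] at ha hb
    have hprod : ‖∏ j ∈ s, a j‖ ≤ 1 :=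
      (Finset.norm_prod_le _ _).trans (Finset.prod_le_one (fun _ _ => norm_nonneg _) ha.2)
    rw [Finset.prod_cons, Finset.prod_cons, Finset.sum_cons]
    calc ‖a i * ∏ j ∈ s, a j - b i * ∏ j ∈ s, b j‖
        = ‖(a i - b i) * ∏ j ∈ s, a j + b i * (∏ j ∈ s, a j - ∏ j ∈ s, b j)‖ := by ring_nf
      _ ≤ ‖a i - b i‖ * ‖∏ j ∈ s, a j‖ + ‖b i‖ * ‖∏ j ∈ s, a j - ∏ j ∈ s, b j‖ :=
        norm_add_le_of_le (norm_mul_le _ _) (norm_mul_le _ _)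
      _ ≤ ‖a i - b i‖ * 1 + 1 * ∑ j ∈ s, ‖a j - b j‖ := by
        gcongr
        exacts [hb.1, ih ha.2 hb.2]
      _ = _ := by ring

section CharFun

variable {Ω : Type*} [MeasurableSpace Ω] {P : Measure Ω} [IsProbabilityMeasure P] {X : Ω → ℝ}

theorem norm_charFun_map_sub_taylor_two_le (hX : MemLp X 4 P) (h0 : ∫ ω, X ω ∂P = 0) (t : ℝ) :
    ‖charFun (P.map X) t - (1 - t ^ 2 * (∫ ω, X ω ^ 2 ∂P) / 2 : ℝ)‖ ≤
      4 * |t| ^ 3 * ∫ ω, |X ω| ^ 3 ∂P := by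
  have hX1 : Integrable (fun ω => (t * X ω) * Complex.I : Ω → ℂ) P :=
    ((hX.integrable (by norm_num)).ofReal.const_mul (t : ℂ)).mul_const _
  have hX2 : Integrable (fun ω => (t * X ω) ^ 2 / 2 : Ω → ℂ) P := by
    have hX' : Integrable (fun ω => ((t * X ω) ^ 2 / 2 : ℝ)) P :=
      ((hX.mono_exponent (p := 2) (by norm_num)).const_mul t).integrable_sq.div_const 2
    simpa using hX'.ofReal (𝕜 := ℂ)
  have hX3 : Integrable (fun ω => 4 * |t| ^ 3 * |X ω| ^ 3) P :=
    (MemLp.integrable_norm_pow (p := 3) (hX.mono_exponent (by norm_num)) (by norm_num)).const_mul _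
  have hexp : Integrable (fun ω => Complex.exp (t * X ω * Complex.I)) P := by
    refine Integrable.of_bound
      (Complex.continuous_exp.comp_aestronglyMeasurable hX1.aestronglyMeasurable) 1
      (ae_of_all _ fun ω => ?_)
    rw [← Complex.ofReal_mul, Complex.norm_exp_ofReal_mul_I]
  have htaylor : ∫ ω, (1 + (t * X ω) * Complex.I - (t * X ω) ^ 2 / 2 : ℂ) ∂P =
      (1 - t ^ 2 * (∫ ω, X ω ^ 2 ∂P) / 2 : ℝ) := by
    rw [integral_sub ((integrable_const _).fun_add hX1) hX2, integral_add (integrable_const _) hX1]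
    simp only [integral_mul_const, integral_const_mul, integral_div, mul_pow, ← Complex.ofReal_pow,
      integral_complex_ofReal, h0]
    simp
  have hpoly : Integrable (fun ω => 1 + (t * X ω) * Complex.I - (t * X ω) ^ 2 / 2 : Ω → ℂ) P :=
    ((integrable_const _).add hX1).sub hX2
  rw [charFun_apply_real, integral_map hX.aestronglyMeasurable.aemeasurable (by fun_prop),
    ← htaylor, ← integral_sub hexp hpoly, ← integral_const_mul]
  refine norm_integral_le_of_norm_le hX3 (ae_of_all _ fun ω => ?_)
  simpa [abs_mul, mul_pow, mul_assoc] using norm_exp_mul_I_sub_taylor_two_le (t * X ω)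

theorem sq_integral_sq_le_integral_pow_four (hX : MemLp X 4 P) :
    (∫ ω, X ω ^ 2 ∂P) ^ 2 ≤ ∫ ω, X ω ^ 4 ∂P := by
  simpa [← pow_mul] using sq_integral_mul_le (memLp_two_sq hX) (memLp_const (1 : ℝ))

theorem norm_charFun_map_sub_charFun_gaussian_le (hX : MemLp X 4 P) (h0 : ∫ ω, X ω ∂P = 0)
    (t : ℝ) :
    ‖charFun (P.map X) t - Real.exp (-(t ^ 2 * (∫ ω, X ω ^ 2 ∂P) / 2))‖ ≤
      4 * |t| ^ 3 * √((∫ ω, X ω ^ 2 ∂P) * ∫ ω, X ω ^ 4 ∂P) + t ^ 4 / 4 * ∫ ω, X ω ^ 4 ∂P := by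
  have : 0 ≤ ∫ ω, X ω ^ 2 ∂P := integral_nonneg fun ω => sq_nonneg _
  refine (norm_sub_le_norm_sub_add_norm_sub _
    ((1 - t ^ 2 * (∫ ω, X ω ^ 2 ∂P) / 2 : ℝ) : ℂ) _).trans (add_le_add ?_ ?_)
  · refine (norm_charFun_map_sub_taylor_two_le hX h0 t).trans ?_
    gcongr
    exact integral_abs_pow_three_le hX
  · rw [← Complex.ofReal_sub, Complex.norm_real, Real.norm_eq_abs, abs_sub_comm]
    calc _ ≤ (t ^ 2 * (∫ ω, X ω ^ 2 ∂P) / 2) ^ 2 := abs_exp_neg_sub_one_sub_le (by positivity)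
      _ = t ^ 4 / 4 * (∫ ω, X ω ^ 2 ∂P) ^ 2 := by ring
      _ ≤ _ := by
        gcongr
        exact sq_integral_sq_le_integral_pow_four hX

end CharFun

theorem norm_charFun_map_sum_sub_le {ι Ω : Type*} [Fintype ι] [MeasurableSpace Ω] {P : Measure Ω}
    [IsProbabilityMeasure P] {X : ι → Ω → ℝ} (hX : ∀ i, MemLp (X i) 4 P)
    (h0 : ∀ i, ∫ ω, X i ω ∂P = 0) (hindep : iIndepFun X P) (t : ℝ) :
    ‖charFun (P.map fun ω => ∑ i, X i ω) t -
        Real.exp (-(t ^ 2 * (∑ i, ∫ ω, X i ω ^ 2 ∂P) / 2))‖ ≤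
      4 * |t| ^ 3 * √((∑ i, ∫ ω, X i ω ^ 2 ∂P) * ∑ i, ∫ ω, X i ω ^ 4 ∂P) +
        t ^ 4 / 4 * ∑ i, ∫ ω, X i ω ^ 4 ∂P := by
  have hm (i : ι) : AEMeasurable (X i) P := (hX i).aestronglyMeasurable.aemeasurable
  have (i : ι) : IsProbabilityMeasure (P.map (X i)) := Measure.isProbabilityMeasure_map (hm i)
  have hv (i : ι) : 0 ≤ ∫ ω, X i ω ^ 2 ∂P := integral_nonneg fun ω => sq_nonneg _
  have h4 (i : ι) : 0 ≤ ∫ ω, X i ω ^ 4 ∂P := integral_nonneg fun ω => by positivity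
  have hexp : Real.exp (-(t ^ 2 * (∑ i, ∫ ω, X i ω ^ 2 ∂P) / 2)) =
      ∏ i, Real.exp (-(t ^ 2 * (∫ ω, X i ω ^ 2 ∂P) / 2)) := by
    rw [← Real.exp_sum, Finset.sum_neg_distrib, Finset.mul_sum, Finset.sum_div]
  rw [hindep.charFun_map_fun_sum_eq_prod hm, hexp, Finset.prod_apply, Complex.ofReal_prod]
  calc _ ≤ ∑ i, ‖charFun (P.map (X i)) t - Real.exp (-(t ^ 2 * (∫ ω, X i ω ^ 2 ∂P) / 2))‖ := by
        refine norm_prod_sub_prod_le _ (fun i _ => norm_charFun_le_one t) fun i _ => ?_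
        rw [Complex.norm_real, Real.norm_of_nonneg (Real.exp_nonneg _), Real.exp_le_one_iff,
          neg_nonpos]
        have := hv i
        positivity
    _ ≤ ∑ i, (4 * |t| ^ 3 * √((∫ ω, X i ω ^ 2 ∂P) * ∫ ω, X i ω ^ 4 ∂P) +
          t ^ 4 / 4 * ∫ ω, X i ω ^ 4 ∂P) :=
        Finset.sum_le_sum fun i _ => norm_charFun_map_sub_charFun_gaussian_le (hX i) (h0 i) t
    _ ≤ _ := by
        rw [Finset.sum_add_distrib, ← Finset.mul_sum, ← Finset.mul_sum,
          Real.sqrt_mul (Finset.sum_nonneg fun i _ => hv i)]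
        gcongr
        simp only [Real.sqrt_mul (hv _)]
        exact Real.sum_sqrt_mul_sqrt_le _ hv h4

theorem tendstoInDistribution_sum_of_tendsto_sum_fourth_moment {ι Ω : ℕ → Type*}
    [∀ n, Fintype (ι n)] [∀ n, MeasurableSpace (Ω n)] {P : ∀ n, Measure (Ω n)}
    [∀ n, IsProbabilityMeasure (P n)] {X : ∀ n, ι n → Ω n → ℝ} {v : ℝ≥0}
    (hX : ∀ n i, MemLp (X n i) 4 (P n)) (h0 : ∀ n i, ∫ ω, X n i ω ∂(P n) = 0)
    (hindep : ∀ n, iIndepFun (X n) (P n))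
    (h2 : Tendsto (fun n => ∑ i, ∫ ω, X n i ω ^ 2 ∂(P n)) atTop (𝓝 v))
    (h4 : Tendsto (fun n => ∑ i, ∫ ω, X n i ω ^ 4 ∂(P n)) atTop (𝓝 0)) :
    TendstoInDistribution (fun n ω => ∑ i, X n i ω) atTop (id : ℝ → ℝ) P (gaussianReal 0 v) where
  forall_aemeasurable n :=
    Finset.aemeasurable_fun_sum _ fun i _ => (hX n i).aestronglyMeasurable.aemeasurable
  aemeasurable_limit := aemeasurable_id
  tendsto := by
    refine ProbabilityMeasure.tendsto_iff_tendsto_charFun.2 fun t => ?_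
    have hgauss : charFun (gaussianReal 0 v) t = Real.exp (-(t ^ 2 * v / 2)) := by
      rw [charFun_gaussianReal]
      push_cast
      ring_nf
    simp only [ProbabilityMeasure.coe_mk, Measure.map_id, hgauss]
    have hlim : Tendsto (fun n => ((Real.exp (-(t ^ 2 * (∑ i, ∫ ω, X n i ω ^ 2 ∂(P n)) / 2)) : ℝ)
        : ℂ)) atTop (𝓝 (Real.exp (-(t ^ 2 * v / 2)))) :=
      (Continuous.tendsto (f := fun s : ℝ => ((Real.exp (-(t ^ 2 * s / 2)) : ℝ) : ℂ))
        (by fun_prop) _).comp h2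
    have herror := (((h2.mul h4).sqrt.const_mul (4 * |t| ^ 3)).add (h4.const_mul (t ^ 4 / 4)))
    simp only [mul_zero, Real.sqrt_zero, add_zero] at herror
    refine (tendsto_iff_of_dist (squeeze_zero (fun _ => dist_nonneg) (fun n => ?_) herror)).2 hlim
    rw [dist_eq_norm]
    exact norm_charFun_map_sum_sub_le (hX n) (h0 n) (hindep n) t

end Lyapunov

section Andreief

open Matrix in
theorem integral_det_mul_det {ι α 𝕜 : Type*} [Fintype ι] [DecidableEq ι] [MeasurableSpace α]
    [RCLike 𝕜] {μ : Measure α} [SigmaFinite μ] {φ ψ : ι → α → 𝕜}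
    (hint : ∀ i j, Integrable (fun x => φ i x * ψ j x) μ) :
    ∫ z : ι → α, (of fun i k => φ i (z k)).det * (of fun i k => ψ i (z k)).det
        ∂(Measure.pi fun _ => μ) =
      (Fintype.card ι).factorial * (of fun i j => ∫ x, φ i x * ψ j x ∂μ).det := by
  set A : Matrix ι ι 𝕜 := of fun i j => ∫ x, φ i x * ψ j x ∂μ
  have hleibniz (z : ι → α) : (of fun i k => φ i (z k)).det * (of fun i k => ψ i (z k)).det =
      ∑ σ : Equiv.Perm ι, ∑ τ : Equiv.Perm ι, ((σ.sign : ℤ) : 𝕜) * ((τ.sign : ℤ) : 𝕜) *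
        ∏ k, (φ (σ k) (z k) * ψ (τ k) (z k)) := by
    simp only [det_apply', of_apply, Finset.sum_mul_sum, Finset.prod_mul_distrib, mul_mul_mul_comm]
  have hintp (σ τ : Equiv.Perm ι) : Integrable (fun z : ι → α =>
      ((σ.sign : ℤ) : 𝕜) * ((τ.sign : ℤ) : 𝕜) * ∏ k, (φ (σ k) (z k) * ψ (τ k) (z k)))
      (Measure.pi fun _ => μ) :=
    (Integrable.fintype_prod fun k => hint (σ k) (τ k)).const_mul _
  have hsum (σ : Equiv.Perm ι) :
      ∑ τ : Equiv.Perm ι, ((σ.sign : ℤ) : 𝕜) * ((τ.sign : ℤ) : 𝕜) * ∏ k, A (σ k) (τ k) = A.det := by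
    have hsign : ((σ.sign : ℤ) : 𝕜) * ((σ.sign : ℤ) : 𝕜) = 1 := by
      rw [← Int.cast_mul, ← Units.val_mul, Int.units_mul_self, Units.val_one, Int.cast_one]
    have hdet := det_permute σ A
    rw [← det_transpose, det_apply'] at hdet
    simp only [mul_assoc, ← Finset.mul_sum]
    exact (congrArg _ hdet).trans (by rw [← mul_assoc, hsign, one_mul])
  simp only [hleibniz]
  rw [integral_finsetSum _ fun σ _ => integrable_finsetSum _ fun τ _ => hintp σ τ]
  simp only [integral_finsetSum _ fun τ _ => hintp _ τ, integral_const_mul]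
  have hprod (σ τ : Equiv.Perm ι) : ∫ z : ι → α, ∏ k, (φ (σ k) (z k) * ψ (τ k) (z k))
      ∂(Measure.pi fun _ => μ) = ∏ k, A (σ k) (τ k) :=
    integral_fintype_prod_eq_prod fun k x => φ (σ k) x * ψ (τ k) x
  simp [hprod, hsum, Fintype.card_perm]

end Andreief

section GammaMeasure

variable {a r : ℝ}

theorem integral_gammaMeasure {E : Type*} [NormedAddCommGroup E] [NormedSpace ℝ E]
    (ha : 0 < a) (hr : 0 < r) (h : ℝ → E) :
    ∫ s, h s ∂(gammaMeasure a r) =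
      (r ^ a / Real.Gamma a) • ∫ s in Ioi 0, (s ^ (a - 1) * Real.exp (-(r * s))) • h s := by
  have hpdf (s : ℝ) : (gammaPDF a r s).toReal = gammaPDFReal a r s :=
    ENNReal.toReal_ofReal (gammaPDFReal_nonneg ha hr s)
  have hmeas : Measurable (gammaPDF a r) := (measurable_gammaPDFReal a r).ennreal_ofReal
  rw [gammaMeasure, integral_withDensity_eq_integral_toReal_smul hmeas
    (ae_of_all _ fun _ => ENNReal.ofReal_lt_top), ← integral_smul, ← integral_Ici_eq_integral_Ioi,
    ← integral_indicator measurableSet_Ici]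
  refine integral_congr_ae (ae_of_all _ fun s => ?_)
  by_cases hs : 0 ≤ s <;> simp [hpdf, gammaPDFReal, hs, indicator, smul_smul, mul_assoc]

theorem ae_pos_gammaMeasure (a r : ℝ) : ∀ᵐ s ∂(gammaMeasure a r), 0 < s := by
  have hmeas : Measurable (gammaPDF a r) := (measurable_gammaPDFReal a r).ennreal_ofReal
  rw [gammaMeasure, ae_withDensity_iff hmeas]
  filter_upwards [Measure.ae_ne volume (0 : ℝ)] with s hs hpdf
  contrapose! hpdf
  exact gammaPDF_of_neg (lt_of_le_of_ne hpdf hs)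

theorem integral_pow_gammaMeasure (ha : 0 < a) (hr : 0 < r) (n : ℕ) :
    ∫ s, s ^ n ∂(gammaMeasure a r) = (ascPochhammer ℝ n).eval a / r ^ n := by
  have hGamma : Real.Gamma (a + n) = (ascPochhammer ℝ n).eval a * Real.Gamma a := by
    induction n with
    | zero => simp
    | succ n ih =>
      rw [Nat.cast_succ, ← add_assoc, Real.Gamma_add_one (by positivity), ih,
        ascPochhammer_succ_eval]
      ring
  have hpow : ∫ s in Ioi 0, (s ^ (a - 1) * Real.exp (-(r * s))) • s ^ n =
      ∫ s in Ioi 0, s ^ (a + n - 1) * Real.exp (-(r * s)) := by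
    refine setIntegral_congr_fun measurableSet_Ioi fun s (hs : 0 < s) => ?_
    simp only [smul_eq_mul]
    rw [add_sub_right_comm, Real.rpow_add_natCast hs.ne']
    ring
  rw [integral_gammaMeasure ha hr, hpow, Real.integral_rpow_mul_exp_neg_mul_Ioi (by positivity) hr,
    hGamma, one_div, Real.inv_rpow hr.le, Real.rpow_add_natCast hr.ne', smul_eq_mul]
  have := (Real.Gamma_pos_of_pos ha).ne'
  have := (Real.rpow_pos_of_pos hr a).ne'
  field_simp

theorem integrable_pow_gammaMeasure (ha : 0 < a) (hr : 0 < r) (n : ℕ) :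
    Integrable (fun s => s ^ n) (gammaMeasure a r) := by
  refine Integrable.of_integral_ne_zero ?_
  rw [integral_pow_gammaMeasure ha hr]
  exact (div_pos (ascPochhammer_pos n a ha) (by positivity)).ne'

theorem memLp_id_gammaMeasure (ha : 0 < a) (hr : 0 < r) : MemLp id 4 (gammaMeasure a r) := by
  refine (integrable_norm_rpow_iff aestronglyMeasurable_id (by norm_num) (by norm_num)).1 ?_
  refine (integrable_pow_gammaMeasure ha hr 4).congr (ae_of_all _ fun s => ?_)
  norm_num [Even.pow_abs]

theorem integral_id_gammaMeasure (ha : 0 < a) (hr : 0 < r) :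
    ∫ s, s ∂(gammaMeasure a r) = a / r := by
  simpa using integral_pow_gammaMeasure ha hr 1

theorem variance_id_gammaMeasure (ha : 0 < a) (hr : 0 < r) :
    Var[id; gammaMeasure a r] = a / r ^ 2 := by
  have := isProbabilityMeasure_gammaMeasure ha hr
  rw [variance_eq_sub ((memLp_id_gammaMeasure ha hr).mono_exponent (by norm_num))]
  simp only [Pi.pow_apply, id_eq, integral_pow_gammaMeasure ha hr, integral_id_gammaMeasure ha hr,
    ascPochhammer_succ_eval, ascPochhammer_zero, Polynomial.eval_one]
  push_cast
  field_simp
  ring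

theorem integral_sub_pow_four_gammaMeasure (ha : 0 < a) (hr : 0 < r) :
    ∫ s, (s - a / r) ^ 4 ∂(gammaMeasure a r) = (3 * a ^ 2 + 6 * a) / r ^ 4 := by
  have hexpand (s : ℝ) : (s - a / r) ^ 4 =
      ∑ m ∈ Finset.range 5, s ^ m * ((-(a / r)) ^ (4 - m) * (Nat.choose 4 m)) := by
    simp only [sub_eq_add_neg, add_pow, mul_assoc]
  simp only [hexpand]
  rw [integral_finsetSum _ fun m _ => (integrable_pow_gammaMeasure ha hr m).mul_const _]
  simp only [integral_mul_const, integral_pow_gammaMeasure ha hr, Finset.sum_range_succ,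
    Finset.sum_range_zero, Nat.choose, ascPochhammer_succ_eval, ascPochhammer_zero,
    Polynomial.eval_one]
  push_cast
  field_simp
  ring

end GammaMeasure

section Kostlan

open scoped ComplexConjugate

theorem integral_radial_mul_pow_mul_conj_pow_eq_zero (F : ℝ → ℂ) {a b : ℕ} (hab : a ≠ b) :
    ∫ z : ℂ, F ‖z‖ * (z ^ a * conj z ^ b) = 0 := by
  have hab' : (a : ℂ) - b ≠ 0 := sub_ne_zero.2 (Nat.cast_injective.ne hab)
  set c : Circle := Circle.exp (Real.pi / ((a : ℝ) - b)) with hc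
  have hcc : (c : ℂ) ^ a * conj (c : ℂ) ^ b = -1 := by
    rw [hc, Circle.coe_exp, ← Complex.exp_conj, ← Complex.exp_nat_mul, ← Complex.exp_nat_mul,
      ← Complex.exp_add, map_mul, Complex.conj_I, Complex.conj_ofReal, ← Complex.exp_pi_mul_I]
    congr 1
    push_cast
    field_simp
    ring
  have hrot (z : ℂ) : F ‖rotation c z‖ * (rotation c z ^ a * conj (rotation c z) ^ b) =
      -(F ‖z‖ * (z ^ a * conj z ^ b)) := by
    rw [LinearIsometryEquiv.norm_map, rotation_apply, map_mul, mul_pow, mul_pow]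
    linear_combination (F ‖z‖ * (z ^ a * conj z ^ b)) * hcc
  have hinv := (rotation c).measurePreserving.integral_comp
    (rotation c).toHomeomorph.measurableEmbedding fun z : ℂ => F ‖z‖ * (z ^ a * conj z ^ b)
  simp only [hrot, integral_neg] at hinv
  exact self_eq_neg.1 hinv.symm

theorem integral_comp_sq_norm {E : Type*} [NormedAddCommGroup E] [NormedSpace ℝ E] (F : ℝ → E) :
    ∫ z : ℂ, F (‖z‖ ^ 2) = Real.pi • ∫ s in Ioi 0, F s := by
  have hsubst := integral_comp_rpow_Ioi_of_pos (g := F) two_pos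
  norm_num at hsubst
  rw [integral_fun_norm_addHaar (μ := volume) fun r => F (r ^ 2), Complex.finrank_real_complex,
    measureReal_def, Complex.volume_ball, ← hsubst]
  simp only [mul_smul, integral_smul]
  simp [smul_comm Real.pi, ← Nat.cast_smul_eq_nsmul ℝ]

theorem integral_gaussianWeight {E : Type*} [NormedAddCommGroup E] [NormedSpace ℝ E] (N : ℕ)
    (F : ℂ → E) :
    ∫ z, F z ∂(gaussianWeight N) = ∫ z, Real.exp (-(N : ℝ) * ‖z‖ ^ 2) • F z := by
  rw [gaussianWeight, integral_withDensity_eq_integral_toReal_smul (measurable_gaussianDensity N)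
    (ae_of_all _ fun _ => ENNReal.ofReal_lt_top)]
  simp only [ENNReal.toReal_ofReal (Real.exp_nonneg _)]

/-- The law of the `k`-th squared modulus, `k = 0, …, N - 1`, in Kostlan's description of the
Ginibre eigenvalues: a sum of `k + 1` independent exponential variables of rate `N`. -/
noncomputable def kostlanLaw (N k : ℕ) : Measure ℝ :=
  gammaMeasure (k + 1) N

theorem isProbabilityMeasure_kostlanLaw {N : ℕ} (hN : 0 < N) (k : ℕ) :
    IsProbabilityMeasure (kostlanLaw N k) :=
  isProbabilityMeasure_gammaMeasure (by positivity) (by positivity)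

instance instIsProbabilityMeasureKostlanLaw (N : ℕ) (k : Fin N) :
    IsProbabilityMeasure (kostlanLaw N k) :=
  isProbabilityMeasure_kostlanLaw k.pos k

/-- The total mass of `‖z‖ ^ (2 * k)` under the Gaussian weight. -/
noncomputable def gaussianMoment (N k : ℕ) : ℝ :=
  Real.pi * k.factorial / (N : ℝ) ^ (k + 1)

theorem integral_norm_pow_smul_gaussianWeight {E : Type*} [NormedAddCommGroup E]
    [NormedSpace ℝ E] {N : ℕ} (hN : 0 < N) (k : ℕ) (h : ℝ → E) :
    ∫ z, ‖z‖ ^ (2 * k) • h (‖z‖ ^ 2) ∂(gaussianWeight N) =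
      gaussianMoment N k • ∫ s, h s ∂(kostlanLaw N k) := by
  have hN' : (0 : ℝ) < N := Nat.cast_pos.2 hN
  simp only [integral_gaussianWeight, smul_smul, pow_mul]
  rw [integral_comp_sq_norm fun s => (Real.exp (-(N : ℝ) * s) * s ^ k) • h s, kostlanLaw,
    integral_gammaMeasure (by positivity) hN', smul_smul, gaussianMoment,
    Real.Gamma_nat_eq_factorial, add_sub_cancel_right]
  simp only [← Nat.cast_add_one, Real.rpow_natCast, neg_mul, mul_comm (Real.exp _)]
  congr 1
  field_simp

theorem integrable_bounded_mul_pow_mul_conj_pow {N : ℕ} (hN : 0 < N) {h : ℂ → ℂ}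
    (hm : Measurable h) {M : ℝ} (hM : ∀ z, ‖h z‖ ≤ M) (a b : ℕ) :
    Integrable (fun z => h z * z ^ a * conj z ^ b) (gaussianWeight N) := by
  refine ((integrable_gaussianWeight (a + b) N hN).const_mul M).mono'
    (by fun_prop) (ae_of_all _ fun z => ?_)
  rw [norm_mul, norm_mul, norm_pow, norm_pow, RCLike.norm_conj, mul_assoc, ← pow_add]
  have := (norm_nonneg _).trans (hM z)
  gcongr
  · exact hM z
  · linarith

theorem ofReal_vandermondeSq {N : ℕ} (z : Fin N → ℂ) :
    (vandermondeSq z : ℂ) = (Matrix.vandermonde z).det * conj (Matrix.vandermonde z).det := by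
  rw [Complex.mul_conj, Matrix.det_vandermonde, Complex.normSq_eq_norm_sq, vandermondeSq]
  simp only [norm_prod, ← Finset.prod_pow, norm_sub_rev]

open Matrix in
theorem prod_mul_vandermondeSq_eq_det_mul_det {N : ℕ} (h : ℂ → ℂ) (z : Fin N → ℂ) :
    (∏ k, h (z k)) * vandermondeSq z =
      (of fun i k : Fin N => h (z k) * z k ^ (i : ℕ)).det *
        (of fun i k : Fin N => conj (z k) ^ (i : ℕ)).det := by
  have hconj : (of fun i k : Fin N => conj (z k) ^ (i : ℕ)) =
      ((starRingEnd ℂ).mapMatrix (vandermonde z))ᵀ := by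
    ext i k
    simp [vandermonde_apply]
  have hrow : (of fun i k : Fin N => h (z k) * z k ^ (i : ℕ)).det =
      (∏ k, h (z k)) * (vandermonde z).det := by
    rw [← det_transpose (vandermonde z)]
    exact det_mul_row _ _
  rw [ofReal_vandermondeSq, hconj, hrow, det_transpose, ← RingHom.map_det, mul_assoc]

theorem integral_radial_mul_pow_mul_conj_pow_gaussianWeight {N : ℕ} (hN : 0 < N) (h : ℝ → ℂ)
    (a b : ℕ) :
    ∫ z, h (‖z‖ ^ 2) * z ^ a * conj z ^ b ∂(gaussianWeight N) =
      if a = b then gaussianMoment N a * ∫ s, h s ∂(kostlanLaw N a) else 0 := by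
  split_ifs with hab
  · rw [← hab, ← Complex.real_smul, ← integral_norm_pow_smul_gaussianWeight hN]
    refine integral_congr_ae (ae_of_all _ fun z => ?_)
    simp only [mul_assoc, ← mul_pow, Complex.mul_conj, Complex.normSq_eq_norm_sq, pow_mul,
      Complex.real_smul, Complex.ofReal_pow]
    ring
  · rw [integral_gaussianWeight, ← integral_radial_mul_pow_mul_conj_pow_eq_zero
      (fun r => Real.exp (-(N : ℝ) * r ^ 2) • h (r ^ 2)) hab]
    simp only [smul_mul_assoc, mul_assoc]

theorem integral_prod_ginibreUnnormalized (N : ℕ) {h : ℝ → ℂ} (hm : Measurable h) {M : ℝ}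
    (hM : ∀ s, ‖h s‖ ≤ M) :
    ∫ z, ∏ k, h (‖z k‖ ^ 2) ∂(ginibreUnnormalized N) =
      N.factorial * ∏ k : Fin N, (gaussianMoment N k * ∫ s, h s ∂(kostlanLaw N k)) := by
  rw [ginibreUnnormalized, integral_withDensity_eq_integral_toReal_smul
    (f := fun z => ENNReal.ofReal (vandermondeSq z))
    (continuous_vandermondeSq N).measurable.ennreal_ofReal
    (ae_of_all _ fun _ => ENNReal.ofReal_lt_top)]
  have hdet (z : Fin N → ℂ) :
      (ENNReal.ofReal (vandermondeSq z)).toReal • ∏ k, h (‖z k‖ ^ 2) =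
      (Matrix.of fun i k : Fin N => h (‖z k‖ ^ 2) * z k ^ (i : ℕ)).det *
        (Matrix.of fun i k : Fin N => conj (z k) ^ (i : ℕ)).det := by
    rw [ENNReal.toReal_ofReal (vandermondeSq_nonneg z), Complex.real_smul, mul_comm,
      prod_mul_vandermondeSq_eq_det_mul_det fun w => h (‖w‖ ^ 2)]
  have hgram : (Matrix.of fun i j : Fin N =>
      ∫ z, h (‖z‖ ^ 2) * z ^ (i : ℕ) * conj z ^ (j : ℕ) ∂(gaussianWeight N)) =
      Matrix.diagonal fun k : Fin N => gaussianMoment N k * ∫ s, h s ∂(kostlanLaw N k) := by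
    ext i j
    simp only [Matrix.of_apply, Matrix.diagonal_apply, Fin.ext_iff,
      integral_radial_mul_pow_mul_conj_pow_gaussianWeight i.pos]
  simp only [hdet]
  rw [integral_det_mul_det (φ := fun (i : Fin N) z => h (‖z‖ ^ 2) * z ^ (i : ℕ))
    (ψ := fun (i : Fin N) z => conj z ^ (i : ℕ)), hgram, Matrix.det_diagonal, Fintype.card_fin]
  exact fun i j => integrable_bounded_mul_pow_mul_conj_pow i.pos (by fun_prop) (fun z => hM _) i j

theorem integral_prod_ginibre (N : ℕ) {h : ℝ → ℂ} (hm : Measurable h) {M : ℝ}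
    (hM : ∀ s, ‖h s‖ ≤ M) :
    ∫ z, ∏ k, h (‖z k‖ ^ 2) ∂(ginibre N) = ∏ k : Fin N, ∫ s, h s ∂(kostlanLaw N k) := by
  have hZ := integral_prod_ginibreUnnormalized N (h := fun _ => 1) measurable_const
    (fun _ => norm_one.le)
  have hmoment : ∏ k : Fin N, (gaussianMoment N k : ℂ) ≠ 0 := by
    refine Finset.prod_ne_zero_iff.2 fun k _ => Complex.ofReal_ne_zero.2 ?_
    have : (0 : ℝ) < N := Nat.cast_pos.2 k.pos
    unfold gaussianMoment
    positivity
  have hfactorial : (N.factorial : ℂ) ≠ 0 := Nat.cast_ne_zero.2 N.factorial_ne_zero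
  simp only [Finset.prod_const_one, integral_const, probReal_univ, one_smul, mul_one,
    Complex.real_smul] at hZ
  rw [ginibre, integral_smul_measure, integral_prod_ginibreUnnormalized N hm hM,
    ENNReal.toReal_inv, ← measureReal_def, Complex.real_smul, Complex.ofReal_inv, hZ,
    Finset.prod_mul_distrib]
  field_simp

theorem measurable_linearStatistic (N : ℕ) {F : ℂ → ℝ} (hF : Measurable F) :
    Measurable (linearStatistic N F) := by
  unfold linearStatistic
  fun_prop

theorem measurable_comp_sqrt {f : ℝ → ℝ} (hf : Measurable (radial f)) :
    Measurable fun s => f √s := by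
  have : (fun s => f √s) = fun s : ℝ => radial f (√s : ℝ) := by
    funext s
    simp [radial, abs_of_nonneg (Real.sqrt_nonneg s)]
  rw [this]
  fun_prop

theorem identDistrib_linearStatistic_ginibre (N : ℕ) {f : ℝ → ℝ} (hf : Measurable (radial f)) :
    IdentDistrib (linearStatistic N (radial f)) (fun s : Fin N → ℝ => ∑ k, f √(s k)) (ginibre N)
      (Measure.pi fun k : Fin N => kostlanLaw N k) := by
  have hφ := measurable_comp_sqrt hf
  set φ : ℝ → ℝ := fun s => f √s with hφ_def
  have hX : AEMeasurable (linearStatistic N (radial f)) (ginibre N) :=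
    (measurable_linearStatistic N hf).aemeasurable
  have hY : AEMeasurable (fun s : Fin N → ℝ => ∑ k, φ (s k))
      (Measure.pi fun k : Fin N => kostlanLaw N k) :=
    (Finset.measurable_fun_sum _ fun k _ => hφ.comp (measurable_pi_apply k)).aemeasurable
  refine ⟨hX, hY, ?_⟩
  have := Measure.isProbabilityMeasure_map hX
  have := Measure.isProbabilityMeasure_map hY
  refine Measure.ext_of_charFun (funext fun t => ?_)
  have hexp (x : Fin N → ℝ) : Complex.exp (t * (∑ k, x k : ℝ) * Complex.I) =
      ∏ k, Complex.exp (t * x k * Complex.I) := by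
    rw [← Complex.exp_sum, Complex.ofReal_sum, Finset.mul_sum, Finset.sum_mul]
  have hkostlan := integral_prod_ginibre N (h := fun s => Complex.exp (t * φ s * Complex.I))
    (by fun_prop) (M := 1) fun s => by
      rw [← Complex.ofReal_mul, Complex.norm_exp_ofReal_mul_I]
  simp only [hφ_def, Real.sqrt_sq (norm_nonneg _)] at hkostlan
  rw [charFun_apply_real, charFun_apply_real, integral_map hX (by fun_prop),
    integral_map hY (by fun_prop)]
  simp only [linearStatistic, radial, hexp, hkostlan]
  exact (integral_fintype_prod_eq_prod fun _ s => Complex.exp (t * φ s * Complex.I)).symm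

end Kostlan

section DeltaMethod

variable {Ω ι : Type*} [MeasurableSpace Ω] {l : Filter ι}

theorem sq_covariance_le {μ : Measure Ω} [IsFiniteMeasure μ] {Y Z : Ω → ℝ} (hY : MemLp Y 2 μ)
    (hZ : MemLp Z 2 μ) : cov[Y, Z; μ] ^ 2 ≤ Var[Y; μ] * Var[Z; μ] := by
  rw [variance_eq_integral hY.aestronglyMeasurable.aemeasurable,
    variance_eq_integral hZ.aestronglyMeasurable.aemeasurable]
  exact sq_integral_mul_le (hY.sub (memLp_const _)) (hZ.sub (memLp_const _))

theorem tendsto_mul_variance_add {μ : ι → Measure Ω} {Y Z : Ω → ℝ} {a : ι → ℝ} {v : ℝ}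
    (hμ : ∀ᶠ i in l, IsFiniteMeasure (μ i)) (hY : ∀ᶠ i in l, MemLp Y 2 (μ i))
    (hZ : ∀ᶠ i in l, MemLp Z 2 (μ i)) (hYv : Tendsto (fun i => a i * Var[Y; μ i]) l (𝓝 v))
    (hZ0 : Tendsto (fun i => a i * Var[Z; μ i]) l (𝓝 0)) :
    Tendsto (fun i => a i * Var[Y + Z; μ i]) l (𝓝 v) := by
  have hcov : Tendsto (fun i => a i * cov[Y, Z; μ i]) l (𝓝 0) := by
    have hprod := (hYv.mul hZ0).sqrt
    rw [mul_zero, Real.sqrt_zero] at hprod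
    refine squeeze_zero_norm' ?_ hprod
    filter_upwards [hμ, hY, hZ] with i _ hYi hZi
    refine Real.abs_le_sqrt ?_
    calc (a i * cov[Y, Z; μ i]) ^ 2 = a i ^ 2 * cov[Y, Z; μ i] ^ 2 := mul_pow _ _ _
      _ ≤ a i ^ 2 * (Var[Y; μ i] * Var[Z; μ i]) := by gcongr; exact sq_covariance_le hYi hZi
      _ = _ := by ring
  have hsum := (hYv.add (hcov.const_mul 2)).add hZ0
  rw [mul_zero, add_zero, add_zero] at hsum
  refine hsum.congr' ?_
  filter_upwards [hμ, hY, hZ] with i _ hYi hZi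
  rw [variance_add hYi hZi]
  ring

theorem memLp_of_abs_sub_le_mul {μ : Measure Ω} [IsFiniteMeasure μ] {X Y : Ω → ℝ} {p : ℝ≥0∞}
    (hX : MemLp X p μ) (hY : AEStronglyMeasurable Y μ) {a b K : ℝ}
    (h : ∀ᵐ ω ∂μ, |Y ω - b| ≤ K * |X ω - a|) : MemLp Y p μ := by
  have hYb : MemLp (fun ω => Y ω - b) p μ :=
    (hX.sub (memLp_const a)).of_le_mul (hY.sub aestronglyMeasurable_const) h
  have hYbb : MemLp (fun ω => Y ω - b + b) p μ := hYb.add (memLp_const b)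
  simpa only [sub_add_cancel] using hYbb

theorem variance_le_integral_sq_sub {μ : Measure Ω} [IsProbabilityMeasure μ] {X : Ω → ℝ}
    (hX : AEStronglyMeasurable X μ) (b : ℝ) : Var[X; μ] ≤ ∫ ω, (X ω - b) ^ 2 ∂μ := by
  rw [← variance_sub_const hX b]
  exact variance_le_expectation_sq (hX.sub aestronglyMeasurable_const)

theorem exists_sq_sub_linear_le {φ : ℝ → ℝ} {d u : ℝ} (hφ : HasDerivAt φ d u) (K : ℝ) {η : ℝ}
    (hη : 0 < η) :
    ∃ C, ∀ s, |φ s - φ u| ≤ K * |s - u| →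
      (φ s - φ u - d * (s - u)) ^ 2 ≤ η * (s - u) ^ 2 + C * (s - u) ^ 4 := by
  obtain ⟨ρ, hρ, hnear⟩ := Metric.eventually_nhds_iff.1
    (hφ.isLittleO.def (Real.sqrt_pos.2 hη))
  refine ⟨((K + |d|) / ρ) ^ 2, fun s hs => ?_⟩
  rcases lt_or_ge (dist s u) ρ with h | h
  · have hsmall := hnear h
    rw [Real.norm_eq_abs, Real.norm_eq_abs, smul_eq_mul, mul_comm (s - u)] at hsmall
    calc (φ s - φ u - d * (s - u)) ^ 2 ≤ (√η * |s - u|) ^ 2 := sq_le_sq' (abs_le.1 hsmall).1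
          (abs_le.1 hsmall).2
      _ = η * (s - u) ^ 2 := by rw [mul_pow, Real.sq_sqrt hη.le, sq_abs]
      _ ≤ _ := le_add_of_nonneg_right (by positivity)
  · rw [Real.dist_eq] at h
    have hfar : |φ s - φ u - d * (s - u)| ≤ (K + |d|) * |s - u| := by
      rw [add_mul, ← abs_mul]
      exact (abs_sub _ _).trans (by gcongr)
    calc (φ s - φ u - d * (s - u)) ^ 2 ≤ ((K + |d|) * |s - u|) ^ 2 :=
          sq_le_sq' (abs_le.1 hfar).1 (abs_le.1 hfar).2
      _ = ((K + |d|) / ρ) ^ 2 * (ρ ^ 2 * |s - u| ^ 2) := by field_simp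
      _ ≤ ((K + |d|) / ρ) ^ 2 * (|s - u| ^ 2 * |s - u| ^ 2) := by gcongr
      _ = ((K + |d|) / ρ) ^ 2 * (s - u) ^ 4 := by rw [sq_abs]; ring
      _ ≤ _ := le_add_of_nonneg_left (by positivity)

theorem integral_sq_sub_linear_le {μ : Measure ℝ} [IsProbabilityMeasure μ] (hμ : MemLp id 4 μ)
    {φ : ℝ → ℝ} {d u η C : ℝ}
    (h : ∀ᵐ s ∂μ, (φ s - φ u - d * (s - u)) ^ 2 ≤ η * (s - u) ^ 2 + C * (s - u) ^ 4) :
    ∫ s, (φ s - φ u - d * (s - u)) ^ 2 ∂μ ≤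
      η * ∫ s, (s - u) ^ 2 ∂μ + C * ∫ s, (s - u) ^ 4 ∂μ := by
  have hcentred : MemLp (fun s => s - u) 4 μ := hμ.sub (memLp_const u)
  have h2 : Integrable (fun s => (s - u) ^ 2) μ :=
    (hcentred.mono_exponent (p := 2) (by norm_num)).integrable_sq
  have h4 : Integrable (fun s => (s - u) ^ 4) μ := by
    simpa only [← pow_mul] using (memLp_two_sq hcentred).integrable_sq
  rw [← integral_const_mul, ← integral_const_mul,
    ← integral_add (h2.const_mul _) (h4.const_mul _)]
  exact integral_mono_of_nonneg (ae_of_all _ fun s => sq_nonneg _)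
    ((h2.const_mul _).fun_add (h4.const_mul _)) h

theorem tendsto_mul_integral_sq_sub_linear {μ : ι → Measure ℝ} {φ : ℝ → ℝ} {a : ι → ℝ}
    {d u K w : ℝ} (hφ : HasDerivAt φ d u) (ha : ∀ i, 0 ≤ a i)
    (hμ : ∀ᶠ i in l, IsProbabilityMeasure (μ i)) (hX : ∀ᶠ i in l, MemLp id 4 (μ i))
    (hK : ∀ᶠ i in l, ∀ᵐ s ∂(μ i), |φ s - φ u| ≤ K * |s - u|)
    (h2 : Tendsto (fun i => a i * ∫ s, (s - u) ^ 2 ∂(μ i)) l (𝓝 w))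
    (h4 : Tendsto (fun i => a i * ∫ s, (s - u) ^ 4 ∂(μ i)) l (𝓝 0)) :
    Tendsto (fun i => a i * ∫ s, (φ s - φ u - d * (s - u)) ^ 2 ∂(μ i)) l (𝓝 0) := by
  have hnonneg (i : ι) : 0 ≤ a i * ∫ s, (φ s - φ u - d * (s - u)) ^ 2 ∂(μ i) :=
    mul_nonneg (ha i) (integral_nonneg fun s => sq_nonneg _)
  refine tendsto_order.2 ⟨fun e he => Eventually.of_forall fun i => he.trans_le (hnonneg i),
    fun e he => ?_⟩
  obtain ⟨η, hη, hηe⟩ : ∃ η > 0, η * w < e := by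
    have hlim : Tendsto (fun η => η * w) (𝓝[>] 0) (𝓝 (0 * w)) :=
      (tendsto_id.mul_const w).mono_left nhdsWithin_le_nhds
    rw [zero_mul] at hlim
    exact ((eventually_mem_nhdsWithin).and (hlim.eventually_lt_const he)).exists
  obtain ⟨C, hC⟩ := exists_sq_sub_linear_le hφ K hη
  have hbound := (h2.const_mul η).add (h4.const_mul C)
  rw [mul_zero, add_zero] at hbound
  filter_upwards [hμ, hX, hK, hbound.eventually_lt_const hηe] with i _ hXi hKi hi
  refine lt_of_le_of_lt ?_ hi
  calc a i * ∫ s, (φ s - φ u - d * (s - u)) ^ 2 ∂(μ i)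
      ≤ a i * (η * ∫ s, (s - u) ^ 2 ∂(μ i) + C * ∫ s, (s - u) ^ 4 ∂(μ i)) :=
        mul_le_mul_of_nonneg_left (integral_sq_sub_linear_le hXi (hKi.mono hC)) (ha i)
    _ = _ := by ring

theorem tendsto_mul_variance_of_hasDerivAt {μ : ι → Measure ℝ} {φ : ℝ → ℝ} {a : ι → ℝ}
    {d u K v w : ℝ} (hφm : Measurable φ) (hφ : HasDerivAt φ d u) (ha : ∀ i, 0 ≤ a i)
    (hμ : ∀ᶠ i in l, IsProbabilityMeasure (μ i)) (hX : ∀ᶠ i in l, MemLp id 4 (μ i))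
    (hK : ∀ᶠ i in l, ∀ᵐ s ∂(μ i), |φ s - φ u| ≤ K * |s - u|)
    (hv : Tendsto (fun i => a i * Var[id; μ i]) l (𝓝 v))
    (h2 : Tendsto (fun i => a i * ∫ s, (s - u) ^ 2 ∂(μ i)) l (𝓝 w))
    (h4 : Tendsto (fun i => a i * ∫ s, (s - u) ^ 4 ∂(μ i)) l (𝓝 0)) :
    Tendsto (fun i => a i * Var[φ; μ i]) l (𝓝 (d ^ 2 * v)) := by
  have hlinear : Tendsto (fun i => a i * Var[d • id; μ i]) l (𝓝 (d ^ 2 * v)) := by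
    simpa only [variance_smul, mul_left_comm] using hv.const_mul (d ^ 2)
  have hrem : Tendsto (fun i => a i * Var[φ - d • id; μ i]) l (𝓝 0) := by
    refine squeeze_zero' (Eventually.of_forall fun i => mul_nonneg (ha i) (variance_nonneg _ _)) ?_
      (tendsto_mul_integral_sq_sub_linear hφ ha hμ hX hK h2 h4)
    filter_upwards [hμ] with i _
    refine mul_le_mul_of_nonneg_left ?_ (ha i)
    refine (variance_le_integral_sq_sub (by fun_prop) (φ u - d * u)).trans_eq
      (integral_congr_ae (ae_of_all _ fun s => ?_))
    simp only [Pi.sub_apply, Pi.smul_apply, id_eq, smul_eq_mul]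
    ring
  have hid : ∀ᶠ i in l, MemLp (d • id) 2 (μ i) := by
    filter_upwards [hμ, hX] with i _ hXi
    exact (hXi.mono_exponent (by norm_num)).const_smul d
  have hφ2 : ∀ᶠ i in l, MemLp φ 2 (μ i) := by
    filter_upwards [hμ, hX, hK] with i _ hXi hKi
    exact memLp_of_abs_sub_le_mul (hXi.mono_exponent (by norm_num))
      hφm.aestronglyMeasurable hKi
  simpa only [add_sub_cancel] using tendsto_mul_variance_add (hμ.mono fun _ _ => inferInstance) hid
    (hφ2.and hid |>.mono fun _ h => h.1.sub h.2) hlinear hrem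

end DeltaMethod

section KostlanAsymptotics

theorem integral_sub_const_pow_four_le {Ω : Type*} [MeasurableSpace Ω] {μ : Measure Ω}
    [IsProbabilityMeasure μ] {X : Ω → ℝ} (hX : MemLp X 4 μ) (a b : ℝ) :
    ∫ ω, (X ω - a) ^ 4 ∂μ ≤ 8 * (∫ ω, (X ω - b) ^ 4 ∂μ + (b - a) ^ 4) := by
  have hXb : MemLp (fun ω => X ω - b) 4 μ := hX.sub (memLp_const b)
  have hint : Integrable (fun ω => (X ω - b) ^ 4) μ := by
    simpa only [← pow_mul] using (memLp_two_sq hXb).integrable_sq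
  calc ∫ ω, (X ω - a) ^ 4 ∂μ
      ≤ ∫ ω, 8 * ((X ω - b) ^ 4 + (b - a) ^ 4) ∂μ := by
        refine integral_mono_of_nonneg (ae_of_all _ fun ω => by positivity)
          ((hint.add (integrable_const _)).const_mul 8) (ae_of_all _ fun ω => ?_)
        have := Even.add_pow_le (n := 4) (a := X ω - b) (b := b - a) (by decide)
        rw [sub_add_sub_cancel] at this
        exact this.trans_eq (by norm_num)
    _ = 8 * (∫ ω, (X ω - b) ^ 4 ∂μ + (b - a) ^ 4) := by
        rw [integral_const_mul, integral_add hint (integrable_const _), integral_const,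
          probReal_univ, one_smul]

theorem integral_sub_integral_pow_four_le {Ω : Type*} [MeasurableSpace Ω] {μ : Measure Ω}
    [IsProbabilityMeasure μ] {X : Ω → ℝ} (hX : MemLp X 4 μ) (b : ℝ) :
    ∫ ω, (X ω - ∫ ω', X ω' ∂μ) ^ 4 ∂μ ≤ 16 * ∫ ω, (X ω - b) ^ 4 ∂μ := by
  have hXb : MemLp (fun ω => X ω - b) 4 μ := hX.sub (memLp_const b)
  have hmean : (b - ∫ ω, X ω ∂μ) ^ 4 ≤ ∫ ω, (X ω - b) ^ 4 ∂μ :=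
    calc (b - ∫ ω, X ω ∂μ) ^ 4 = (∫ ω, (X ω - b) ∂μ) ^ 4 := by
          rw [integral_sub (hX.integrable (by norm_num)) (integrable_const b), integral_const,
            probReal_univ, one_smul]
          ring
      _ ≤ _ := Even.convexOn_pow (n := 4) (by decide) |>.map_integral_le
        (continuous_pow 4).continuousOn isClosed_univ (ae_of_all _ fun _ => mem_univ _)
        (hXb.integrable (by norm_num)) (by
          simpa only [Function.comp_def, ← pow_mul] using (memLp_two_sq hXb).integrable_sq)
  linarith [integral_sub_const_pow_four_le hX (∫ ω, X ω ∂μ) b]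

theorem integral_sub_const_sq {Ω : Type*} [MeasurableSpace Ω] {μ : Measure Ω}
    [IsProbabilityMeasure μ] {X : Ω → ℝ} (hX : MemLp X 2 μ) (b : ℝ) :
    ∫ ω, (X ω - b) ^ 2 ∂μ = Var[X; μ] + (∫ ω, X ω ∂μ - b) ^ 2 := by
  have hvar := variance_eq_sub (hX.sub (memLp_const b))
  rw [← variance_sub_const hX.aestronglyMeasurable b]
  change Var[fun ω => X ω - b; μ] = ∫ ω, (X ω - b) ^ 2 ∂μ - (∫ ω, (X ω - b) ∂μ) ^ 2 at hvar
  rw [hvar, integral_sub (hX.integrable one_le_two) (integrable_const b), integral_const,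
    probReal_univ, one_smul]
  ring

variable {N : ℕ}

theorem ae_pos_kostlanLaw (N k : ℕ) : ∀ᵐ s ∂(kostlanLaw N k), 0 < s :=
  ae_pos_gammaMeasure _ _

theorem memLp_id_kostlanLaw (hN : 0 < N) (k : ℕ) : MemLp id 4 (kostlanLaw N k) :=
  memLp_id_gammaMeasure (by positivity) (Nat.cast_pos.2 hN)

theorem integral_id_kostlanLaw (hN : 0 < N) (k : ℕ) :
    ∫ s, s ∂(kostlanLaw N k) = (k + 1) / N :=
  integral_id_gammaMeasure (by positivity) (Nat.cast_pos.2 hN)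

theorem natCast_mul_variance_id_kostlanLaw (hN : 0 < N) (k : ℕ) :
    N * Var[id; kostlanLaw N k] = (k + 1) / N := by
  have : (0 : ℝ) < N := Nat.cast_pos.2 hN
  rw [kostlanLaw, variance_id_gammaMeasure (by positivity) this]
  field_simp

theorem integral_sub_mean_pow_four_kostlanLaw_le (hN : 0 < N) (k : ℕ) :
    ∫ s, (s - (k + 1) / N) ^ 4 ∂(kostlanLaw N k) ≤
      9 * ((k + 1) / N : ℝ) ^ 2 / N ^ 2 := by
  have : (0 : ℝ) < N := Nat.cast_pos.2 hN
  rw [kostlanLaw, integral_sub_pow_four_gammaMeasure (by positivity) this, div_pow, mul_div_assoc',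
    div_div, ← pow_add]
  gcongr
  nlinarith [(Nat.cast_nonneg k : (0 : ℝ) ≤ k)]

theorem tendsto_floor_mul_add_one_div {u : ℝ} (hu : 0 ≤ u) :
    Tendsto (fun N : ℕ => ((⌊u * N⌋₊ + 1 : ℝ) / N)) atTop (𝓝 u) := by
  have hfloor := (tendsto_nat_floor_mul_div_atTop hu).comp (tendsto_natCast_atTop_atTop (R := ℝ))
  have hsum := hfloor.add tendsto_inv_atTop_nhds_zero_nat
  rw [add_zero] at hsum
  exact hsum.congr fun N => by simp only [Function.comp_apply, add_div, one_div]

theorem abs_floor_mul_add_one_div_sub_le {u : ℝ} (hu : 0 ≤ u) (hN : 0 < N) :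
    |(⌊u * N⌋₊ + 1 : ℝ) / N - u| ≤ 1 / N := by
  have hN' : (0 : ℝ) < N := Nat.cast_pos.2 hN
  have hle := Nat.floor_le (mul_nonneg hu hN'.le)
  have hlt := Nat.lt_floor_add_one (u * N)
  rw [div_sub' hN'.ne', abs_div, abs_of_pos hN']
  exact div_le_div_of_nonneg_right (abs_le.2 ⟨by linarith, by linarith⟩) hN'.le

theorem tendsto_natCast_mul_variance_id_kostlanLaw {u : ℝ} (hu : 0 ≤ u) :
    Tendsto (fun N : ℕ => N * Var[id; kostlanLaw N ⌊u * N⌋₊]) atTop (𝓝 u) := by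
  refine (tendsto_floor_mul_add_one_div hu).congr' ?_
  filter_upwards [eventually_gt_atTop 0] with N hN
  exact (natCast_mul_variance_id_kostlanLaw hN _).symm

theorem tendsto_natCast_mul_integral_sq_sub_kostlanLaw {u : ℝ} (hu : 0 ≤ u) :
    Tendsto (fun N : ℕ => N * ∫ s, (s - u) ^ 2 ∂(kostlanLaw N ⌊u * N⌋₊)) atTop (𝓝 u) := by
  have hbias : Tendsto (fun N : ℕ => N * ((⌊u * N⌋₊ + 1 : ℝ) / N - u) ^ 2) atTop (𝓝 0) := by
    refine squeeze_zero' (Eventually.of_forall fun N => by positivity) ?_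
      tendsto_one_div_atTop_nhds_zero_nat
    filter_upwards [eventually_gt_atTop 0] with N hN
    have : (0 : ℝ) < N := Nat.cast_pos.2 hN
    calc N * ((⌊u * N⌋₊ + 1 : ℝ) / N - u) ^ 2 ≤ N * (1 / N : ℝ) ^ 2 := by
          rw [← sq_abs]
          gcongr
          exact abs_floor_mul_add_one_div_sub_le hu hN
      _ = 1 / (N : ℝ) := by field_simp
  have hsum := (tendsto_natCast_mul_variance_id_kostlanLaw hu).add hbias
  rw [add_zero] at hsum
  refine hsum.congr' ?_
  filter_upwards [eventually_gt_atTop 0] with N hN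
  have := isProbabilityMeasure_kostlanLaw hN ⌊u * N⌋₊
  have hid : MemLp id 2 (kostlanLaw N ⌊u * N⌋₊) :=
    (memLp_id_kostlanLaw hN _).mono_exponent (by norm_num)
  rw [← mul_add, ← integral_id_kostlanLaw hN]
  exact congrArg _ (integral_sub_const_sq hid u).symm

theorem tendsto_natCast_mul_integral_pow_four_sub_kostlanLaw {u : ℝ} (hu : 0 ≤ u) :
    Tendsto (fun N : ℕ => N * ∫ s, (s - u) ^ 4 ∂(kostlanLaw N ⌊u * N⌋₊)) atTop (𝓝 0) := by
  have hinv := tendsto_one_div_atTop_nhds_zero_nat (𝕜 := ℝ)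
  have hbound := (((((tendsto_floor_mul_add_one_div hu).pow 2).const_mul 9).mul hinv).add
    (hinv.pow 3)).const_mul 8
  simp only [mul_zero, add_zero, ne_eq, OfNat.ofNat_ne_zero, not_false_eq_true, zero_pow] at hbound
  refine squeeze_zero' (Eventually.of_forall fun N =>
    mul_nonneg N.cast_nonneg (integral_nonneg fun s => by positivity)) ?_ hbound
  filter_upwards [eventually_gt_atTop 0] with N hN
  have : (0 : ℝ) < N := Nat.cast_pos.2 hN
  have := isProbabilityMeasure_kostlanLaw hN ⌊u * N⌋₊
  set c : ℝ := (⌊u * N⌋₊ + 1 : ℝ) / N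
  have hbias : (c - u) ^ 4 ≤ (1 / N : ℝ) ^ 4 := by
    rw [← Even.pow_abs (by decide)]
    exact pow_le_pow_left₀ (abs_nonneg _) (abs_floor_mul_add_one_div_sub_le hu hN) 4
  calc N * ∫ s, (s - u) ^ 4 ∂(kostlanLaw N ⌊u * N⌋₊)
      ≤ N * (8 * (9 * c ^ 2 / (N : ℝ) ^ 2 + (1 / N : ℝ) ^ 4)) := by
        gcongr
        refine (integral_sub_const_pow_four_le (memLp_id_kostlanLaw hN _) u c).trans ?_
        gcongr
        exact integral_sub_mean_pow_four_kostlanLaw_le hN _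
    _ = 8 * (9 * c ^ 2 * (1 / N) + (1 / N : ℝ) ^ 3) := by field_simp

theorem tendsto_natCast_mul_variance_kostlanLaw {φ : ℝ → ℝ} {d u K : ℝ} (hu : 0 ≤ u)
    (hφm : Measurable φ) (hφ : HasDerivAt φ d u)
    (hK : ∀ s, 0 < s → |φ s - φ u| ≤ K * |s - u|) :
    Tendsto (fun N : ℕ => N * Var[φ; kostlanLaw N ⌊u * N⌋₊]) atTop (𝓝 (d ^ 2 * u)) :=
  tendsto_mul_variance_of_hasDerivAt hφm hφ (fun N => N.cast_nonneg)
    ((eventually_gt_atTop 0).mono fun _ hN => isProbabilityMeasure_kostlanLaw hN _)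
    ((eventually_gt_atTop 0).mono fun _ hN => memLp_id_kostlanLaw hN _)
    (Eventually.of_forall fun N => (ae_pos_kostlanLaw N _).mono hK)
    (tendsto_natCast_mul_variance_id_kostlanLaw hu)
    (tendsto_natCast_mul_integral_sq_sub_kostlanLaw hu)
    (tendsto_natCast_mul_integral_pow_four_sub_kostlanLaw hu)

end KostlanAsymptotics

section UnitInterval

theorem integral_comp_natFloor {E : Type*} [NormedAddCommGroup E] [NormedSpace ℝ E]
    [CompleteSpace E] (a : ℕ → E) (n : ℕ) :
    ∫ x in (0 : ℝ)..n, a ⌊x⌋₊ = ∑ k ∈ Finset.range n, a k := by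
  have hfloor (k : ℕ) : EqOn (fun x : ℝ => a ⌊x⌋₊) (fun _ => a k) (Ioo (k : ℝ) (k + 1 : ℕ)) :=
    fun x hx => congrArg a ((Nat.floor_eq_iff (k.cast_nonneg.trans hx.1.le)).2
      ⟨hx.1.le, hx.2.trans_eq (Nat.cast_succ k)⟩)
  have hle (k : ℕ) : (k : ℝ) ≤ (k + 1 : ℕ) := Nat.cast_le.2 k.le_succ
  have hint (k : ℕ) : IntervalIntegrable (fun x : ℝ => a ⌊x⌋₊) volume k (k + 1 : ℕ) := by
    rw [intervalIntegrable_iff_integrableOn_Ioo_of_le (hle k)]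
    exact (integrableOn_const (by simp)).congr_fun (hfloor k).symm measurableSet_Ioo
  have hsum := intervalIntegral.sum_integral_adjacent_intervals (n := n) fun k _ => hint k
  rw [Nat.cast_zero] at hsum
  rw [← hsum]
  refine Finset.sum_congr rfl fun k _ => ?_
  rw [intervalIntegral.integral_congr_Ioo_of_le (hle k) (hfloor k),
    intervalIntegral.integral_const, Nat.cast_succ, add_sub_cancel_left, one_smul]

theorem tendsto_inv_smul_sum {E : Type*} [NormedAddCommGroup E] [NormedSpace ℝ E]
    [CompleteSpace E] {a : ℕ → ℕ → E} {h : ℝ → E} {C : ℝ} (hC : ∀ N, ∀ k < N, ‖a N k‖ ≤ C)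
    (ha : ∀ᵐ u : ℝ, u ∈ Ioo 0 1 → Tendsto (fun N : ℕ => a N ⌊u * N⌋₊) atTop (𝓝 (h u))) :
    Tendsto (fun N : ℕ => (N : ℝ)⁻¹ • ∑ k : Fin N, a N k) atTop
      (𝓝 (∫ u in (0 : ℝ)..1, h u)) := by
  have hlim : Tendsto (fun N : ℕ => ∫ u in (0 : ℝ)..1, a N ⌊u * N⌋₊) atTop
      (𝓝 (∫ u in (0 : ℝ)..1, h u)) := by
    refine intervalIntegral.tendsto_integral_filter_of_dominated_convergence (fun _ => C) ?_ ?_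
      intervalIntegrable_const ?_
    · exact Eventually.of_forall fun N =>
        (StronglyMeasurable.of_discrete (f := a N)).comp_measurable
        (by fun_prop) |>.aestronglyMeasurable
    · filter_upwards [eventually_gt_atTop 0] with N hN
      filter_upwards [Measure.ae_ne volume 1] with u hu1 hu
      rw [uIoc_of_le zero_le_one] at hu
      refine hC N _ ((Nat.floor_lt (by have := hu.1; positivity)).2 ?_)
      exact mul_lt_of_lt_one_left (Nat.cast_pos.2 hN) (hu.2.lt_of_ne hu1)
    · filter_upwards [ha, Measure.ae_ne volume 1] with u hu hu1 hmem
      rw [uIoc_of_le zero_le_one] at hmem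
      exact hu ⟨hmem.1, hmem.2.lt_of_ne hu1⟩
  refine hlim.congr' ?_
  filter_upwards [eventually_gt_atTop 0] with N hN
  rw [intervalIntegral.integral_comp_mul_right (fun x => a N ⌊x⌋₊) (Nat.cast_ne_zero.2 hN.ne'),
    zero_mul, one_mul, integral_comp_natFloor, Finset.sum_range]

theorem integral_comp_sqrt (h : ℝ → ℝ) :
    ∫ u in (0 : ℝ)..1, h √u = 2 * ∫ r in (0 : ℝ)..1, h r * r := by
  have hsubst := intervalIntegral.integral_comp_mul_deriv_of_deriv_nonneg (a := 0) (b := 1)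
    (f := fun r : ℝ => r ^ 2) (f' := fun r => 2 * r) (g := fun u => h √u)
    (continuous_pow 2).continuousOn (fun r _ => by simpa using hasDerivAt_pow 2 r)
    (fun r hr => by rw [min_eq_left zero_le_one] at hr; linarith [hr.1])
  rw [zero_pow two_ne_zero, one_pow] at hsubst
  rw [← hsubst, ← intervalIntegral.integral_const_mul]
  refine intervalIntegral.integral_congr fun r hr => ?_
  rw [uIcc_of_le zero_le_one] at hr
  simp only [Function.comp_apply, Real.sqrt_sq hr.1]
  ring

theorem ae_comp_sqrt {p : ℝ → Prop} (hp : ∀ᵐ r : ℝ, p r) : ∀ᵐ u : ℝ, 0 < u → p √u := by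
  have hnull : volume ((fun r : ℝ => r ^ 2) '' {r | ¬p r}) = 0 :=
    addHaar_image_eq_zero_of_differentiableOn_of_addHaar_eq_zero volume
      (differentiable_pow 2).differentiableOn hp
  filter_upwards [measure_eq_zero_iff_ae_notMem.1 hnull] with u hu hu0
  by_contra h
  exact hu ⟨√u, h, Real.sq_sqrt hu0.le⟩

end UnitInterval

section LipschitzProfile

/-- A radial profile that is Lipschitz on `(0, 1]` and of at most linear growth, the class of
test functions treated here. The Lipschitz bound reaches past the edge `1` of the unit disc because
the eigenvalues are confined to the disc only asymptotically. -/
structure IsLipschitzProfile (f : ℝ → ℝ) : Prop where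
  measurable : Measurable (radial f)
  lipschitz : ∃ L : ℝ≥0, ∀ a ∈ Ioc (0 : ℝ) 1, ∀ r, 0 < r → |f r - f a| ≤ L * |r - a|

variable {f g : ℝ → ℝ}

theorem IsLipschitzProfile.add (hf : IsLipschitzProfile f) (hg : IsLipschitzProfile g) :
    IsLipschitzProfile (f + g) := by
  obtain ⟨K, hK⟩ := hf.lipschitz
  obtain ⟨L, hL⟩ := hg.lipschitz
  refine ⟨hf.measurable.add hg.measurable, K + L, fun a ha r hr => ?_⟩
  rw [Pi.add_apply, Pi.add_apply, add_sub_add_comm, NNReal.coe_add, add_mul]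
  exact (abs_add_le _ _).trans (add_le_add (hK a ha r hr) (hL a ha r hr))

theorem IsLipschitzProfile.exists_lipschitzOnWith (hf : IsLipschitzProfile f) :
    ∃ L, LipschitzOnWith L f (Ioo 0 1) := by
  obtain ⟨L, hL⟩ := hf.lipschitz
  exact ⟨L, LipschitzOnWith.of_dist_le_mul fun r hr a ha => hL a (Ioo_subset_Ioc_self ha) r hr.1⟩

theorem IsLipschitzProfile.ae_differentiableAt (hf : IsLipschitzProfile f) :
    ∀ᵐ r : ℝ, r ∈ Ioo 0 1 → DifferentiableAt ℝ f r := by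
  obtain ⟨L, hL⟩ := hf.exists_lipschitzOnWith
  filter_upwards [hL.ae_differentiableWithinAt_of_mem_real] with r hdiff hr
  exact (hdiff hr).differentiableAt (Ioo_mem_nhds hr.1 hr.2)

theorem IsLipschitzProfile.exists_abs_deriv_le (hf : IsLipschitzProfile f) :
    ∃ L : ℝ≥0, ∀ r ∈ Ioo (0 : ℝ) 1, |deriv f r| ≤ L := by
  obtain ⟨L, hL⟩ := hf.exists_lipschitzOnWith
  exact ⟨L, fun r hr => norm_deriv_le_of_lipschitzOn (Ioo_mem_nhds hr.1 hr.2) hL⟩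

theorem IsLipschitzProfile.intervalIntegrable (hf : IsLipschitzProfile f)
    (hg : IsLipschitzProfile g) :
    IntervalIntegrable (fun r => deriv f r * deriv g r * r) volume 0 1 := by
  obtain ⟨K, hK⟩ := hf.exists_abs_deriv_le
  obtain ⟨L, hL⟩ := hg.exists_abs_deriv_le
  rw [intervalIntegrable_iff_integrableOn_Ioo_of_le zero_le_one]
  refine IntegrableOn.of_bound (by simp) (((measurable_deriv f).mul (measurable_deriv g)).mul
    measurable_id).aestronglyMeasurable (K * L * 1) ?_
  filter_upwards [ae_restrict_mem measurableSet_Ioo] with r hr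
  rw [norm_mul, norm_mul]
  gcongr
  · exact hK r hr
  · exact hL r hr
  · exact (abs_of_pos hr.1).trans_le hr.2.le

theorem IsLipschitzProfile.limitCov_add (hf : IsLipschitzProfile f) (hg : IsLipschitzProfile g) :
    limitCov (f + g) (f + g) = limitCov f f + 2 * limitCov f g + limitCov g g := by
  have hff := hf.intervalIntegrable hf
  have hfg := hf.intervalIntegrable hg
  have hgg := hg.intervalIntegrable hg
  have hexpand : ∫ r in (0 : ℝ)..1, deriv (f + g) r * deriv (f + g) r * r =
      ∫ r in (0 : ℝ)..1, (deriv f r * deriv f r * r + 2 * (deriv f r * deriv g r * r) +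
        deriv g r * deriv g r * r) := by
    refine intervalIntegral.integral_congr_ae ?_
    filter_upwards [hf.ae_differentiableAt, hg.ae_differentiableAt, Measure.ae_ne volume 1]
      with r hfr hgr hr1 hmem
    rw [uIoc_of_le zero_le_one] at hmem
    have hr : r ∈ Ioo 0 1 := ⟨hmem.1, hmem.2.lt_of_ne hr1⟩
    rw [deriv_add (hfr hr) (hgr hr)]
    ring
  unfold limitCov
  rw [hexpand, intervalIntegral.integral_add (hff.add (hfg.const_mul 2)) hgg,
    intervalIntegral.integral_add hff (hfg.const_mul 2), intervalIntegral.integral_const_mul]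
  ring

theorem limitCov_self_eq_integral_sqrt (f : ℝ → ℝ) :
    limitCov f f = ∫ u in (0 : ℝ)..1, deriv f √u ^ 2 / 4 := by
  rw [integral_comp_sqrt fun r => deriv f r ^ 2 / 4, limitCov,
    ← intervalIntegral.integral_const_mul, ← intervalIntegral.integral_const_mul]
  refine intervalIntegral.integral_congr fun r _ => ?_
  ring

theorem abs_sqrt_sub_sqrt_le {s c : ℝ} (hs : 0 ≤ s) (hc : 0 < c) :
    |√s - √c| ≤ |s - c| / √c := by
  have hc' : 0 < √c := Real.sqrt_pos.2 hc
  rw [le_div_iff₀ hc']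
  calc |√s - √c| * √c ≤ |√s - √c| * |√s + √c| := by
        gcongr
        exact (le_add_of_nonneg_left (Real.sqrt_nonneg s)).trans (le_abs_self _)
    _ = |s - c| := by
        rw [← abs_mul, mul_comm, ← sq_sub_sq, Real.sq_sqrt hs, Real.sq_sqrt hc.le]

theorem IsLipschitzProfile.exists_abs_comp_sqrt_sub_le (hf : IsLipschitzProfile f) :
    ∃ L : ℝ≥0, ∀ c ∈ Ioc (0 : ℝ) 1, ∀ s, 0 < s → |f √s - f √c| ≤ L / √c * |s - c| := by
  obtain ⟨L, hL⟩ := hf.lipschitz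
  refine ⟨L, fun c hc s hs => ?_⟩
  calc |f √s - f √c| ≤ L * |√s - √c| :=
        hL _ ⟨Real.sqrt_pos.2 hc.1, Real.sqrt_le_one.2 hc.2⟩ _ (Real.sqrt_pos.2 hs)
    _ ≤ L * (|s - c| / √c) := by
        gcongr
        exact abs_sqrt_sub_sqrt_le hs.le hc.1
    _ = L / √c * |s - c| := by ring

end LipschitzProfile

section LimitTheorems

theorem tendstoInDistribution_sum_sub_integral_pi {ι : ℕ → Type*} [∀ n, Fintype (ι n)]
    {Ω : ∀ n, ι n → Type*} [∀ n i, MeasurableSpace (Ω n i)] {μ : ∀ n i, Measure (Ω n i)}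
    [∀ n i, IsProbabilityMeasure (μ n i)] {Y : ∀ n i, Ω n i → ℝ} {v : ℝ≥0}
    (hY : ∀ n i, MemLp (Y n i) 4 (μ n i))
    (h2 : Tendsto (fun n => ∑ i, Var[Y n i; μ n i]) atTop (𝓝 v))
    (h4 : Tendsto (fun n => ∑ i, ∫ x, (Y n i x - ∫ y, Y n i y ∂(μ n i)) ^ 4 ∂(μ n i)) atTop
      (𝓝 0)) :
    TendstoInDistribution
      (fun n ω => ∑ i, Y n i (ω i) - ∫ ω', ∑ i, Y n i (ω' i) ∂(Measure.pi (μ n)))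
      atTop (id : ℝ → ℝ) (fun n => Measure.pi (μ n)) (gaussianReal 0 v) := by
  have hmem (n) (i : ι n) : MemLp (fun ω : ∀ i, Ω n i => Y n i (ω i)) 4 (Measure.pi (μ n)) :=
    (hY n i).comp_measurePreserving (measurePreserving_eval (μ n) i)
  have hcenter (n) (i : ι n) : MemLp (fun x => Y n i x - ∫ y, Y n i y ∂(μ n i)) 4 (μ n i) :=
    (hY n i).sub (memLp_const _)
  have heval (n) (i : ι n) (p : ℕ) :
      ∫ ω, (Y n i (ω i) - ∫ y, Y n i y ∂(μ n i)) ^ p ∂(Measure.pi (μ n)) =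
        ∫ x, (Y n i x - ∫ y, Y n i y ∂(μ n i)) ^ p ∂(μ n i) :=
    integral_comp_eval (f := fun x => (Y n i x - ∫ y, Y n i y ∂(μ n i)) ^ p)
      ((hcenter n i).aestronglyMeasurable.pow p)
  have hmean (n) : ∫ ω, ∑ i, Y n i (ω i) ∂(Measure.pi (μ n)) = ∑ i, ∫ x, Y n i x ∂(μ n i) := by
    rw [integral_finsetSum _ fun i _ => (hmem n i).integrable (by norm_num)]
    exact Finset.sum_congr rfl fun i _ => integral_comp_eval (hY n i).aestronglyMeasurable
  simp only [hmean, ← Finset.sum_sub_distrib]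
  refine tendstoInDistribution_sum_of_tendsto_sum_fourth_moment
    (fun n i => (hmem n i).sub (memLp_const _)) (fun n i => ?_)
    (fun n => iIndepFun_pi fun i => (hcenter n i).aestronglyMeasurable.aemeasurable)
    ?_ (by simpa only [heval] using h4)
  · have hzero := heval n i 1
    simp only [pow_one] at hzero
    rw [hzero, integral_sub ((hY n i).integrable (by norm_num)) (integrable_const _),
      integral_const, probReal_univ, one_smul, sub_self]
  · simpa only [heval, variance_eq_integral (hY _ _).aestronglyMeasurable.aemeasurable] using h2

theorem add_one_div_mem_Ioc {N k : ℕ} (hk : k < N) : (k + 1 : ℝ) / N ∈ Ioc (0 : ℝ) 1 := by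
  have hN : (0 : ℝ) < N := Nat.cast_pos.2 (k.zero_le.trans_lt hk)
  exact ⟨by positivity, (div_le_one hN).2 (by exact_mod_cast hk)⟩

theorem integral_pow_le_pow_mul_integral_pow {Ω : Type*} [MeasurableSpace Ω] {μ : Measure Ω}
    {X Y : Ω → ℝ} {K : ℝ} {p : ℕ} (hp : Even p) (hY : Integrable (fun ω => Y ω ^ p) μ)
    (hXY : ∀ᵐ ω ∂μ, |X ω| ≤ K * |Y ω|) :
    ∫ ω, X ω ^ p ∂μ ≤ K ^ p * ∫ ω, Y ω ^ p ∂μ := by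
  rw [← integral_const_mul]
  refine integral_mono_of_nonneg (ae_of_all _ fun ω => hp.pow_nonneg _) (hY.const_mul _) ?_
  filter_upwards [hXY] with ω hω
  rw [← hp.pow_abs, ← hp.pow_abs (Y ω), ← mul_pow]
  exact pow_le_pow_left₀ (abs_nonneg _) hω p

variable {f g : ℝ → ℝ}

theorem IsLipschitzProfile.memLp_comp_sqrt_kostlanLaw (hf : IsLipschitzProfile f) {N k : ℕ}
    (hk : k < N) : MemLp (fun s => f √s) 4 (kostlanLaw N k) := by
  have hN := k.zero_le.trans_lt hk
  have := isProbabilityMeasure_kostlanLaw hN k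
  obtain ⟨L, hL⟩ := hf.exists_abs_comp_sqrt_sub_le
  exact memLp_of_abs_sub_le_mul (memLp_id_kostlanLaw hN k)
    (measurable_comp_sqrt hf.measurable).aestronglyMeasurable
    ((ae_pos_kostlanLaw N k).mono fun s hs => hL 1 (by simp) s hs)

theorem IsLipschitzProfile.exists_natCast_mul_variance_le (hf : IsLipschitzProfile f) :
    ∃ C : ℝ, ∀ N, ∀ k < N, N * Var[fun s => f √s; kostlanLaw N k] ≤ C := by
  obtain ⟨L, hL⟩ := hf.exists_abs_comp_sqrt_sub_le
  refine ⟨L ^ 2, fun N k hk => ?_⟩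
  have hN := k.zero_le.trans_lt hk
  have := isProbabilityMeasure_kostlanLaw hN k
  set c : ℝ := (k + 1 : ℝ) / N with hc
  have hc01 : c ∈ Ioc 0 1 := add_one_div_mem_Ioc hk
  have hid : MemLp id 2 (kostlanLaw N k) :=
    (memLp_id_kostlanLaw hN k).mono_exponent (by norm_num)
  have hvar : Var[id; kostlanLaw N k] = ∫ s, (s - c) ^ 2 ∂(kostlanLaw N k) := by
    rw [variance_eq_integral aemeasurable_id, hc, ← integral_id_kostlanLaw hN]
    rfl
  calc N * Var[fun s => f √s; kostlanLaw N k]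
      ≤ N * ∫ s, (f √s - f √c) ^ 2 ∂(kostlanLaw N k) := by
        gcongr
        exact variance_le_integral_sq_sub
          (measurable_comp_sqrt hf.measurable).aestronglyMeasurable _
    _ ≤ N * ((L / √c) ^ 2 * ∫ s, (s - c) ^ 2 ∂(kostlanLaw N k)) := by
        gcongr
        exact integral_pow_le_pow_mul_integral_pow even_two
          (hid.sub (memLp_const c)).integrable_sq ((ae_pos_kostlanLaw N k).mono (hL c hc01))
    _ = L ^ 2 / c * (N * Var[id; kostlanLaw N k]) := by
        rw [hvar, div_pow, Real.sq_sqrt hc01.1.le]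
        ring
    _ = L ^ 2 := by
        rw [natCast_mul_variance_id_kostlanLaw hN, ← hc, div_mul_cancel₀ _ hc01.1.ne']

theorem IsLipschitzProfile.exists_integral_pow_four_le (hf : IsLipschitzProfile f) :
    ∃ C : ℝ, ∀ N, ∀ k < N, ∫ s, (f √s - ∫ t, f √t ∂(kostlanLaw N k)) ^ 4 ∂(kostlanLaw N k) ≤
      C / N ^ 2 := by
  obtain ⟨L, hL⟩ := hf.exists_abs_comp_sqrt_sub_le
  refine ⟨16 * 9 * L ^ 4, fun N k hk => ?_⟩
  have hN := k.zero_le.trans_lt hk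
  have := isProbabilityMeasure_kostlanLaw hN k
  set c : ℝ := (k + 1 : ℝ) / N
  have hc01 : c ∈ Ioc 0 1 := add_one_div_mem_Ioc hk
  have hXc : MemLp (fun s : ℝ => s - c) 4 (kostlanLaw N k) :=
    (memLp_id_kostlanLaw hN k).sub (memLp_const c)
  have hint : Integrable (fun s : ℝ => (s - c) ^ 4) (kostlanLaw N k) := by
    simpa only [← pow_mul] using (memLp_two_sq hXc).integrable_sq
  calc ∫ s, (f √s - ∫ t, f √t ∂(kostlanLaw N k)) ^ 4 ∂(kostlanLaw N k)
      ≤ 16 * ∫ s, (f √s - f √c) ^ 4 ∂(kostlanLaw N k) :=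
        integral_sub_integral_pow_four_le (hf.memLp_comp_sqrt_kostlanLaw hk) _
    _ ≤ 16 * ((L / √c) ^ 4 * ∫ s, (s - c) ^ 4 ∂(kostlanLaw N k)) := by
        gcongr
        exact integral_pow_le_pow_mul_integral_pow (by decide) hint
          ((ae_pos_kostlanLaw N k).mono (hL c hc01))
    _ ≤ 16 * ((L / √c) ^ 4 * (9 * c ^ 2 / N ^ 2)) := by
        gcongr
        exact integral_sub_mean_pow_four_kostlanLaw_le hN k
    _ = 16 * 9 * L ^ 4 / N ^ 2 := by
        have hsqrt : √c ^ 4 = c ^ 2 := by rw [pow_mul √c 2 2, Real.sq_sqrt hc01.1.le]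
        have := hc01.1.ne'
        rw [div_pow, hsqrt]
        field_simp

theorem IsLipschitzProfile.ae_tendsto_natCast_mul_variance (hf : IsLipschitzProfile f) :
    ∀ᵐ u : ℝ, u ∈ Ioo 0 1 →
      Tendsto (fun N : ℕ => N * Var[fun s => f √s; kostlanLaw N ⌊u * N⌋₊]) atTop
        (𝓝 (deriv f √u ^ 2 / 4)) := by
  obtain ⟨L, hL⟩ := hf.exists_abs_comp_sqrt_sub_le
  filter_upwards [ae_comp_sqrt hf.ae_differentiableAt] with u hdiff hu
  have hsqrt : 0 < √u := Real.sqrt_pos.2 hu.1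
  have hderiv : HasDerivAt (fun s => f √s) (deriv f √u * (1 / (2 * √u))) u :=
    (hdiff hu.1 ⟨hsqrt, (Real.sqrt_lt' one_pos).2 (by simpa using hu.2)⟩).hasDerivAt.comp u
      (Real.hasDerivAt_sqrt hu.1.ne')
  have hvalue : (deriv f √u * (1 / (2 * √u))) ^ 2 * u = deriv f √u ^ 2 / 4 := by
    rw [mul_pow, div_pow, mul_pow, Real.sq_sqrt hu.1.le]
    have := hu.1.ne'
    field_simp
    norm_num
  rw [← hvalue]
  exact tendsto_natCast_mul_variance_kostlanLaw hu.1.le (measurable_comp_sqrt hf.measurable)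
    hderiv (hL u (Ioo_subset_Ioc_self hu))

theorem IsLipschitzProfile.tendsto_sum_variance (hf : IsLipschitzProfile f) :
    Tendsto (fun N : ℕ => ∑ k : Fin N, Var[fun s => f √s; kostlanLaw N k]) atTop
      (𝓝 (limitCov f f)) := by
  obtain ⟨C, hC⟩ := hf.exists_natCast_mul_variance_le
  rw [limitCov_self_eq_integral_sqrt]
  refine (tendsto_inv_smul_sum (a := fun N k => N * Var[fun s => f √s; kostlanLaw N k]) (C := C)
    (fun N k hk => ?_) hf.ae_tendsto_natCast_mul_variance).congr' ?_
  · rw [Real.norm_of_nonneg (mul_nonneg N.cast_nonneg (variance_nonneg _ _))]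
    exact hC N k hk
  · filter_upwards [eventually_ne_atTop 0] with N hN
    rw [← Finset.mul_sum, smul_eq_mul, inv_mul_cancel_left₀ (Nat.cast_ne_zero.2 hN)]

theorem IsLipschitzProfile.tendsto_sum_integral_pow_four (hf : IsLipschitzProfile f) :
    Tendsto (fun N : ℕ => ∑ k : Fin N,
      ∫ s, (f √s - ∫ t, f √t ∂(kostlanLaw N k)) ^ 4 ∂(kostlanLaw N k)) atTop (𝓝 0) := by
  obtain ⟨C, hC⟩ := hf.exists_integral_pow_four_le
  refine squeeze_zero (fun N => Finset.sum_nonneg fun k _ => integral_nonneg fun s => by positivity)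
    (fun N => Finset.sum_le_sum fun k _ => hC N k k.is_lt) ?_
  refine (tendsto_const_div_atTop_nhds_zero_nat C).congr fun N => ?_
  rw [Finset.sum_const, Finset.card_univ, Fintype.card_fin, nsmul_eq_mul]
  rcases eq_or_ne N 0 with rfl | hN
  · simp
  · field_simp

theorem IsLipschitzProfile.memLp_linearStatistic (hf : IsLipschitzProfile f) (N : ℕ) :
    MemLp (linearStatistic N (radial f)) 2 (ginibre N) := by
  rw [(identDistrib_linearStatistic_ginibre N hf.measurable).memLp_iff]
  refine memLp_finsetSum _ fun k _ => ?_
  exact ((hf.memLp_comp_sqrt_kostlanLaw k.is_lt).comp_measurePreserving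
    (measurePreserving_eval _ k)).mono_exponent (by norm_num)

theorem IsLipschitzProfile.variance_linearStatistic (hf : IsLipschitzProfile f) (N : ℕ) :
    Var[linearStatistic N (radial f); ginibre N] =
      ∑ k : Fin N, Var[fun s => f √s; kostlanLaw N k] := by
  rw [(identDistrib_linearStatistic_ginibre N hf.measurable).variance_eq, ← variance_sum_pi fun k =>
    (hf.memLp_comp_sqrt_kostlanLaw k.is_lt).mono_exponent (by norm_num)]
  congr 1
  funext s
  rw [Finset.sum_apply]

theorem IsLipschitzProfile.tendsto_variance_linearStatistic (hf : IsLipschitzProfile f) :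
    Tendsto (fun N : ℕ => Var[linearStatistic N (radial f); ginibre N]) atTop
      (𝓝 (limitCov f f)) := by
  simpa only [hf.variance_linearStatistic] using hf.tendsto_sum_variance

theorem linearStatistic_radial_add (N : ℕ) (f g : ℝ → ℝ) :
    linearStatistic N (radial (f + g)) =
      linearStatistic N (radial f) + linearStatistic N (radial g) :=
  funext fun _ => Finset.sum_add_distrib

theorem IsLipschitzProfile.tendsto_covariance_linearStatistic (hf : IsLipschitzProfile f)
    (hg : IsLipschitzProfile g) :
    Tendsto (fun N : ℕ =>
      cov[linearStatistic N (radial f), linearStatistic N (radial g); ginibre N]) atTop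
      (𝓝 (limitCov f g)) := by
  have hpolar (N : ℕ) :
      cov[linearStatistic N (radial f), linearStatistic N (radial g); ginibre N] =
      (Var[linearStatistic N (radial (f + g)); ginibre N] -
        Var[linearStatistic N (radial f); ginibre N] -
        Var[linearStatistic N (radial g); ginibre N]) / 2 := by
    rw [linearStatistic_radial_add,
      variance_add (hf.memLp_linearStatistic N) (hg.memLp_linearStatistic N)]
    ring
  have hlimit : limitCov f g = (limitCov (f + g) (f + g) - limitCov f f - limitCov g g) / 2 := by
    rw [hf.limitCov_add hg]
    ring
  simp only [hpolar]
  rw [hlimit]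
  exact (((hf.add hg).tendsto_variance_linearStatistic.sub
    hf.tendsto_variance_linearStatistic).sub hg.tendsto_variance_linearStatistic).div_const 2

theorem tendstoInDistribution_of_forall_identDistrib {Ω Ω' : ℕ → Type*}
    [∀ n, MeasurableSpace (Ω n)] [∀ n, MeasurableSpace (Ω' n)] {P : ∀ n, Measure (Ω n)}
    {Q : ∀ n, Measure (Ω' n)} [∀ n, IsProbabilityMeasure (P n)] [∀ n, IsProbabilityMeasure (Q n)]
    {X : ∀ n, Ω n → ℝ} {Y : ∀ n, Ω' n → ℝ} {ν : Measure ℝ} [IsProbabilityMeasure ν]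
    (h : ∀ n, IdentDistrib (X n) (Y n) (P n) (Q n))
    (hY : TendstoInDistribution Y atTop (id : ℝ → ℝ) Q ν) :
    TendstoInDistribution X atTop (id : ℝ → ℝ) P ν where
  forall_aemeasurable n := (h n).aemeasurable_fst
  aemeasurable_limit := hY.aemeasurable_limit
  tendsto := hY.tendsto.congr fun n => Subtype.ext (h n).map_eq.symm

theorem IsLipschitzProfile.tendstoInDistribution_linearStatistic (hf : IsLipschitzProfile f) :
    TendstoInDistribution
      (fun (N : ℕ) (z : Fin N → ℂ) =>
        linearStatistic N (radial f) z - ∫ w, linearStatistic N (radial f) w ∂(ginibre N))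
      atTop (id : ℝ → ℝ) (fun N : ℕ => ginibre N)
      (gaussianReal 0 (limitCov f f).toNNReal) := by
  have hident (N : ℕ) := identDistrib_linearStatistic_ginibre N hf.measurable
  simp only [(hident _).integral_eq]
  refine tendstoInDistribution_of_forall_identDistrib (fun N => (hident N).sub_const _) ?_
  refine tendstoInDistribution_sum_sub_integral_pi
    (fun N k => hf.memLp_comp_sqrt_kostlanLaw k.is_lt) ?_ hf.tendsto_sum_integral_pow_four
  rw [Real.coe_toNNReal _ (limitCov_self_nonneg f)]
  exact hf.tendsto_sum_variance

end LimitTheorems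

theorem IsRadialTest.isLipschitzProfile {δ : ℝ≥0} {ε : ℝ} (hε : 0 < ε) {f : ℝ → ℝ}
    (hf : IsRadialTest δ ε f) : IsLipschitzProfile f := by
  obtain ⟨M, hM⟩ := hf.bounded
  obtain ⟨M₁, hM₁⟩ := hf.memC2Holder.bounded 1 (by norm_num)
  have hdiff (r) (hr : r ∈ Ioo 0 (1 + ε)) : DifferentiableAt ℝ f r :=
    (hf.memC2Holder.contDiffOn.differentiableOn (by norm_num)).differentiableAt
      (isOpen_Ioo.mem_nhds hr)
  have hderiv (r) (hr : r ∈ Ioo 0 (1 + ε)) : ‖deriv f r‖ ≤ M₁ := by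
    have := hM₁ r hr
    rwa [iteratedDerivWithin_of_isOpen isOpen_Ioo hr, iteratedDeriv_one] at this
  refine ⟨hf.measurable, (max M₁ (2 * M / ε)).toNNReal, fun a ha r hr => ?_⟩
  have ha' : a ∈ Ioo 0 (1 + ε) := ⟨ha.1, by linarith [ha.2]⟩
  refine le_trans ?_ (mul_le_mul_of_nonneg_right (Real.le_coe_toNNReal _) (abs_nonneg _))
  rcases lt_or_ge r (1 + ε) with hrε | hrε
  · calc |f r - f a| ≤ M₁ * |r - a| :=
          (convex_Ioo 0 (1 + ε)).norm_image_sub_le_of_norm_deriv_le hdiff hderiv ha' ⟨hr, hrε⟩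
      _ ≤ max M₁ (2 * M / ε) * |r - a| := by
          gcongr
          exact le_max_left _ _
  · have hM0 : 0 ≤ M := (abs_nonneg _).trans (hM r hr.le)
    have hra : ε ≤ |r - a| := le_abs.2 (Or.inl (by linarith [ha.2]))
    calc |f r - f a| ≤ 2 * M := (abs_sub _ _).trans (by linarith [hM r hr.le, hM a ha.1.le])
      _ = 2 * M / ε * ε := by field_simp
      _ ≤ max M₁ (2 * M / ε) * |r - a| := by
          gcongr
          exact le_max_right _ _

theorem theorem3_general (f g : ℝ → ℝ) (hf : IsLipschitzProfile f) (hg : IsLipschitzProfile g) :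
    (IntervalIntegrable (fun r => deriv f r * deriv g r * r) volume 0 1 ∧
      Tendsto
        (fun N : ℕ =>
          cov[linearStatistic N (radial f), linearStatistic N (radial g); ginibre N])
        atTop (𝓝 (limitCov f g))) ∧
    TendstoInDistribution
      (fun (N : ℕ) (z : Fin N → ℂ) =>
        linearStatistic N (radial f) z - ∫ w, linearStatistic N (radial f) w ∂(ginibre N))
      atTop (id : ℝ → ℝ) (fun N : ℕ => ginibre N)
      (gaussianReal 0 (limitCov f f).toNNReal) :=
  ⟨⟨hf.intervalIntegrable hg, hf.tendsto_covariance_linearStatistic hg⟩,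
    hf.tendstoInDistribution_linearStatistic⟩

theorem theorem3 (δ : ℝ≥0) (hδ : 0 < δ) (ε : ℝ) (hε : 0 < ε) (f g : ℝ → ℝ)
    (hf : IsRadialTest δ ε f) (hg : IsRadialTest δ ε g) :
    (IntervalIntegrable (fun r => deriv f r * deriv g r * r) volume 0 1 ∧
      Tendsto
        (fun N : ℕ =>
          cov[linearStatistic N (radial f), linearStatistic N (radial g); ginibre N])
        atTop (𝓝 (limitCov f g))) ∧
    TendstoInDistribution
      (fun (N : ℕ) (z : Fin N → ℂ) =>
        linearStatistic N (radial f) z - ∫ w, linearStatistic N (radial f) w ∂(ginibre N))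
      atTop (id : ℝ → ℝ) (fun N : ℕ => ginibre N)
      (gaussianReal 0 (limitCov f f).toNNReal) :=
  theorem3_general f g (hf.isLipschitzProfile hε) (hg.isLipschitzProfile hε)
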